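/- \textbf{Model.} Let $d\in\mathbb N=\{1,2,\dots\}$ and let $\nu$ be a fixed probability measure on $\mathbb R^d$ with $\int|x|\,\nu(dx)<\infty$. For a measurable $m:\mathbb R^d\to\mathbb R$ consider the nonlinear AR($d$) model $$Y_t=m(X_t)+v_t,\quad X_t=(Y_{t-1},\dots,Y_{t-d}),\quad t=1,\dots,T,\qquad X_1=(Y_0,\dots,Y_{-d+1})\sim\nu,\qquad v_t\overset{\text{i.i.d.}}{\sim}N(0,1),$$ with $(v_t)$ independent of $X_1$. Put $f_0=m\mathbf 1_{[0,1]^d}$. An estimator $\hat f_T$ is a real-valued random function on $\mathbb R^d$ that is jointly measurable in the data $\{(Y_t,X_t)\}_{t=1}^T$ and the point of $\mathbb R^d$ (it need not be bounded), and its risk is $$R(\hat f_T,f_0)=\mathrm E\Big[\frac1T\sum_{t=1}^T\big(\hat f_T(X_t^*)-f_0(X_t^*)\big)^2\Big]\in[0,\infty],$$ where $(X_t^*)_{t=1}^T$ is an independent copy of $(X_t)_{t=1}^T$. \textbf{Class of mean functions.} For $p,r\in\mathbb N$, $r\le p$, $\beta,A>0$ and $l<u$, let $C_r^\beta([l,u]^p,A)$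 be the set of functions $f:[l,u]^p\to\mathbb R$ that depend on at most $r$ coordinates, are of class $C^{\lfloor\beta\rfloor}$, and satisfy $$\sum_{|\alpha|_1<\beta}\sup_{[l,u]^p}|\partial^\alpha f|+\sum_{|\alpha|_1=\lfloor\beta\rfloor}\ \sup_{x\ne y\in[l,u]^p}\frac{|\partial^\alpha f(x)-\partial^\alpha f(y)|}{|x-y|_\infty^{\beta-\lfloor\beta\rfloor}}\le A .$$ Let $q\ge0$ be an integer, $\mathbf d=(d_0,\dots,d_{q+1})\in\mathbb N^{q+2}$ with $d_0=d$ and $d_{q+1}=1$, $\mathbf t=(t_0,\dots,t_q)\in\mathbb N^{q+1}$ with $t_i\le d_i$ for all $i$, and $\boldsymbol\beta=(\beta_0,\dots,\beta_q)\in(0,\infty)^{q+1}$. Let $\mathcal G(q,\mathbf d,\mathbf t,\boldsymbol\beta,A)$ be the set of functions $f=g_q\circ\cdots\circ g_0$ on $[0,1]^d$ with $g_i=(g_{ij})_j:[l_i,u_i]^{d_i}\to[l_{i+1},u_{i+1}]^{d_{i+1}}$ and $g_{ij}\in C_{t_i}^{\beta_i}([l_i,u_i]^{d_i},A)$, where $l_0=0$,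 $u_0=1$, $l_i<u_i$, and $|l_{i+1}|,|u_{i+1}|\le A$ for $i=0,\dots,q$. For $\mathbf c=(c_0,\dots,c_d)\in(0,\infty)^{d+1}$ with $\sum_{i=1}^dc_i<1$, let $\mathcal M(\mathbf c,q,\mathbf d,\mathbf t,\boldsymbol\beta,A)$ be the set of measurable $m:\mathbb R^d\to\mathbb R$ with $|m(x)|\le c_0+\sum_{i=1}^dc_i|x_i|$ for all $x\in\mathbb R^d$ and $m|_{[0,1]^d}\in\mathcal G(q,\mathbf d,\mathbf t,\boldsymbol\beta,A)$. Finally put $$\beta_i^*=\beta_i\prod_{\ell=i+1}^q\min(\beta_\ell,1),\qquad \phi_T=\max_{i=0,\dots,q}T^{-\frac{2\beta_i^*}{2\beta_i^*+t_i}} .$$ \textbf{Theorem.} Suppose that $t_j\le\min\{d_0,\dots,d_{j-1}\}$ for all $1\le j\le q$. Then there is a constant $A_0>0$, depending only on $q,\mathbf d,\mathbf t,\boldsymbol\beta$, such that for every $A\ge A_0$, every $\mathbf c$ as above with $c_0\ge A$, and every $\nu$ as above, $$\liminf_{T\to\infty}\ \phi_T^{-1}\,\inf_{\hat f_T}\ \sup_{m\in\mathcal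 M(\mathbf c,q,\mathbf d,\mathbf t,\boldsymbol\beta,A)}R(\hat f_T,f_0)>0,$$ where the infimum is over all estimators $\hat f_T$. -/

import Mathlib

open MeasureTheory ProbabilityTheory Filter
open scoped ENNReal

noncomputable section

namespace NonlinearAR

/-! ### Hölder classes and compositions -/

/-- The cube `[l, u]^p`. -/
def cube (p : ℕ) (l u : ℝ) : Set (Fin p → ℝ) :=
  Set.Icc (fun _ => l) (fun _ => u)

/-- The partial derivative `∂^α f (x)` on the set `s`: the derivative of order `|α|₁` of `f`
applied to the family of coordinate vectors in which `e_i` occurs exactly `α i` times. -/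
def multiDeriv {p : ℕ} (s : Set (Fin p → ℝ)) (α : Fin p → ℕ) (f : (Fin p → ℝ) → ℝ)
    (x : Fin p → ℝ) : ℝ :=
  iteratedFDerivWithin ℝ (∑ i, α i) f s x
    (fun j => Pi.single (finSigmaFinEquiv.symm j).1 (1 : ℝ))

/-- The multi-indices `α` with `|α|₁ = k`. -/
def multiIndices (p k : ℕ) : Finset (Fin p → ℕ) :=
  Finset.piAntidiag Finset.univ k

/-- The Hölder norm of order `β` on `[l, u]^p`, with values in `[0, ∞]`. For a natural number `k`,
`k < β` is the same as `k ∈ range ⌈β⌉₊`; `edist` on `Fin p → ℝ` is the sup-distance. -/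
def holderNorm (p : ℕ) (l u β : ℝ) (f : (Fin p → ℝ) → ℝ) : ℝ≥0∞ :=
  (∑ k ∈ Finset.range ⌈β⌉₊, ∑ α ∈ multiIndices p k,
      ⨆ x ∈ cube p l u, ‖multiDeriv (cube p l u) α f x‖ₑ) +
    ∑ α ∈ multiIndices p ⌊β⌋₊,
      ⨆ (x ∈ cube p l u) (y ∈ cube p l u) (_ : x ≠ y),
        ‖multiDeriv (cube p l u) α f x - multiDeriv (cube p l u) α f y‖ₑ /
          edist x y ^ (β - (⌊β⌋₊ : ℝ))

/-- `f` depends, on `[l, u]^p`, on at most `r` coordinates. -/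
def DependsOnAtMost (p r : ℕ) (l u : ℝ) (f : (Fin p → ℝ) → ℝ) : Prop :=
  ∃ s : Finset (Fin p), s.card ≤ r ∧
    ∀ x ∈ cube p l u, ∀ y ∈ cube p l u, (∀ i ∈ s, x i = y i) → f x = f y

/-- The class `C_r^β([l, u]^p, A)`; only the values of `f` on the cube matter. -/
def holderClass (p r : ℕ) (l u β A : ℝ) : Set ((Fin p → ℝ) → ℝ) :=
  {f | DependsOnAtMost p r l u f ∧
    ContDiffOn ℝ (⌊β⌋₊ : ℕ) f (cube p l u) ∧
    holderNorm p l u β f ≤ ENNReal.ofReal A}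

/-- The partial compositions `g_{k-1} ∘ ⋯ ∘ g_0`, for `k = 0, …, q + 1`. -/
def composite {q : ℕ} {d : Fin (q + 2) → ℕ}
    (g : ∀ i : Fin (q + 1), (Fin (d i.castSucc) → ℝ) → (Fin (d i.succ) → ℝ)) :
    ∀ k : Fin (q + 2), (Fin (d 0) → ℝ) → (Fin (d k) → ℝ) :=
  Fin.induction id (fun i h => g i ∘ h)

/-- The functions whose restriction to `[0, 1]^{d_0}` is in the composition class
`𝒢(q, d, t, β, A)`. It is used for `d_{q+1} = 1`, where `composite g (Fin.last _) x` has exactly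
one coordinate. -/
def compositionClass (q : ℕ) (d : Fin (q + 2) → ℕ) (t : Fin (q + 1) → ℕ)
    (β : Fin (q + 1) → ℝ) (A : ℝ) : Set ((Fin (d 0) → ℝ) → ℝ) :=
  {f | ∃ (l u : Fin (q + 2) → ℝ)
      (g : ∀ i : Fin (q + 1), (Fin (d i.castSucc) → ℝ) → (Fin (d i.succ) → ℝ)),
    l 0 = 0 ∧ u 0 = 1 ∧ (∀ i, l i < u i) ∧
    (∀ i : Fin (q + 1), |l i.succ| ≤ A ∧ |u i.succ| ≤ A) ∧
    (∀ i : Fin (q + 1), Set.MapsTo (g i)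
      (cube (d i.castSucc) (l i.castSucc) (u i.castSucc))
      (cube (d i.succ) (l i.succ) (u i.succ))) ∧
    (∀ (i : Fin (q + 1)) (j : Fin (d i.succ)),
      (fun x => g i x j) ∈
        holderClass (d i.castSucc) (t i) (l i.castSucc) (u i.castSucc) (β i) A) ∧
    ∀ x ∈ cube (d 0) 0 1, ∀ j, f x = composite g (Fin.last (q + 1)) x j}

/-- The class `ℳ₀(c)`: measurable functions with `|m(x)| ≤ c_0 + ∑ c_i |x_i|`. -/
def growthClass {n : ℕ} (c : Fin (n + 1) → ℝ) : Set ((Fin n → ℝ) → ℝ) :=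
  {m | Measurable m ∧ ∀ x, |m x| ≤ c 0 + ∑ i : Fin n, c i.succ * |x i|}

/-- The class `ℳ(c, q, d, t, β, A)`. -/
def meanClass (q : ℕ) (d : Fin (q + 2) → ℕ) (c : Fin (d 0 + 1) → ℝ) (t : Fin (q + 1) → ℕ)
    (β : Fin (q + 1) → ℝ) (A : ℝ) : Set ((Fin (d 0) → ℝ) → ℝ) :=
  growthClass c ∩ compositionClass q d t β A

/-- `β_i^* = β_i ∏_{l > i} min(β_l, 1)`. -/
def effSmoothness {q : ℕ} (β : Fin (q + 1) → ℝ) (i : Fin (q + 1)) : ℝ :=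
  β i * ∏ l ∈ Finset.Ioi i, min (β l) 1

/-- `φ_T = max_i T^{-2 β_i^* / (2 β_i^* + t_i)}`. -/
def rate {q : ℕ} (t : Fin (q + 1) → ℕ) (β : Fin (q + 1) → ℝ) (T : ℕ) : ℝ :=
  Finset.univ.sup' Finset.univ_nonempty fun i =>
    (T : ℝ) ^ (-(2 * effSmoothness β i / (2 * effSmoothness β i + (t i : ℝ))))

/-! ### The autoregressive model -/

/-- `(y, x_1, …, x_{n-1})`, the next vector of lagged values. -/
def pushLag {n : ℕ} (y : ℝ) (x : Fin n → ℝ) : Fin n → ℝ :=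
  fun i => if (i : ℕ) = 0 then y else x ⟨(i : ℕ) - 1, by omega⟩

/-- The sample space of the model: the initial vector `(Y_0, …, Y_{-n+1})` and the noise
sequence; the noise `v_{t+1}` has index `t`. -/
abbrev Sample (n : ℕ) : Type := (Fin n → ℝ) × (ℕ → ℝ)

/-- The initial vector has law `ν` and is independent of the i.i.d. standard normal noise. -/
def modelMeasure {n : ℕ} (ν : Measure (Fin n → ℝ)) : Measure (Sample n) :=
  ν.prod (Measure.infinitePi fun _ : ℕ => gaussianReal 0 1)

/-- The lag vectors: `lagState m ω t` is `X_{t+1} = (Y_t, …, Y_{t-n+1})`. -/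
def lagState {n : ℕ} (m : (Fin n → ℝ) → ℝ) (ω : Sample n) : ℕ → (Fin n → ℝ)
  | 0 => ω.1
  | t + 1 => pushLag (m (lagState m ω t) + ω.2 t) (lagState m ω t)

/-- The response: `response m ω t` is `Y_{t+1} = m(X_{t+1}) + v_{t+1}`. -/
def response {n : ℕ} (m : (Fin n → ℝ) → ℝ) (ω : Sample n) (t : ℕ) : ℝ :=
  m (lagState m ω t) + ω.2 t

/-- The data `(Y_t, X_t)`, `t = 1, …, T`, i.e. the path `Y_{-n+1}, …, Y_T`. -/
def observations {n : ℕ} (m : (Fin n → ℝ) → ℝ) (T : ℕ) (ω : Sample n) :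
    Fin T → ℝ × (Fin n → ℝ) :=
  fun t => (response m ω t, lagState m ω t)

/-- The target `f_0 = m 1_{[0,1]^n}`. -/
def target {n : ℕ} (m : (Fin n → ℝ) → ℝ) : (Fin n → ℝ) → ℝ :=
  (cube n 0 1).indicator m

/-- The estimators from `T` observations: the jointly measurable functions of data and point. -/
def estimators (n T : ℕ) : Set ((Fin T → ℝ × (Fin n → ℝ)) → (Fin n → ℝ) → ℝ) :=
  {f | Measurable (Function.uncurry f)}

/-- The risk `E[T⁻¹ ∑_{t=1}^T (f̂(X_t^*) - f_0(X_t^*))²]` in `[0, ∞]`, where `X^*` is an independent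
copy of `X`: the data come from the first coordinate of a product space, `X^*` from the second. -/
def risk {n : ℕ} (ν : Measure (Fin n → ℝ)) (m : (Fin n → ℝ) → ℝ) (T : ℕ)
    (f : (Fin T → ℝ × (Fin n → ℝ)) → (Fin n → ℝ) → ℝ) : ℝ≥0∞ :=
  ∫⁻ ω : Sample n × Sample n,
    ENNReal.ofReal ((1 / (T : ℝ)) * ∑ t ∈ Finset.range T,
      (f (observations m T ω.1) (lagState m ω.2 t) - target m (lagState m ω.2 t)) ^ 2)
    ∂((modelMeasure ν).prod (modelMeasure ν))

/-- The minimax risk over a class `M` of mean functions. -/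
def minimaxRisk {n : ℕ} (ν : Measure (Fin n → ℝ)) (M : Set ((Fin n → ℝ) → ℝ)) (T : ℕ) : ℝ≥0∞ :=
  ⨅ f ∈ estimators n T, ⨆ m ∈ M, risk ν m T f

end NonlinearAR

end

open NonlinearAR

namespace NonlinearAR

/-! The proof is Assouad's method, with all the variation placed in the one layer `i` that
determines the rate. Put disjoint smooth bumps of height `N ^ (-β i)` on a grid of mesh `1 / N` in
the first `t i` coordinates, each switched on or off by a bit. The layers before `i` copy
coordinates, which is possible because `t i` is at most each of the earlier dimensions; the layers
after `i` apply `z ↦ z ^ min (β l) 1`. Bump heights thus become `δ = N ^ (-β_i^*)` while every layer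
keeps a Hölder norm bounded independently of `N` (`composite_layer`,
`exists_hypothesis_mem_meanClass`). These mean functions are cut off outside the unit cube, so they
are bounded by `1`.

Dependence of the data is handled by two observations. First, from any starting point, after `n = d
0` steps the lag vector has a Lebesgue density at most `1`, and, when `|m| ≤ 1`, at least a positive
constant on the unit cube (`lintegral_lagState_le`, `lintegral_lagState_ge`). Hence the prediction
risk dominates a multiple of the integrated squared risk over the cube (`le_risk`), and after
burn-in a given cell is occupied with probability at most its volume `N ^ (-t i)`.

Second, the Gaussian likelihood is explicit (`lintegral_observations`), and the geometric mean of
two likelihoods is the likelihood of the average mean function times `exp (-D / 8)`, where `D` sums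
the squared differences of the two means along the path (`logLik_add_logLik`). So the Hellinger
affinity is an expectation under a third autoregression, at least `1 - E[D] / 8`. If `E[D] ≤ 2`, no
estimator does well under both means (`two_point`).

Taking `N` of order `T ^ (1 / (2 β_i^* + t i))` keeps `E[D] ≤ 2` for hypotheses differing in one
bit. Summing over the `N ^ t i` cells (`assouad`) gives a bound of order `δ ^ 2`, which is the order
of `φ_T`. -/

/-! ### The noise sequence -/

/-- The law of the noise sequence. -/
noncomputable def noise : Measure (ℕ → ℝ) := Measure.infinitePi fun _ : ℕ => gaussianReal 0 1

instance : IsProbabilityMeasure noise := by unfold noise; infer_instance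

/-- The sequence `a, v 0, v 1, …`. -/
def consSeq (a : ℝ) (v : ℕ → ℝ) : ℕ → ℝ
  | 0 => a
  | k + 1 => v k

@[simp] theorem consSeq_zero (a : ℝ) (v : ℕ → ℝ) : consSeq a v 0 = a := rfl

@[simp] theorem consSeq_succ (a : ℝ) (v : ℕ → ℝ) (k : ℕ) : consSeq a v (k + 1) = v k := rfl

theorem measurable_consSeq : Measurable fun p : ℝ × (ℕ → ℝ) => consSeq p.1 p.2 := by
  refine measurable_pi_lambda _ fun k => ?_
  cases k with
  | zero => exact measurable_fst
  | succ k => exact (measurable_pi_apply k).comp measurable_snd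

/-- Splitting off the first noise variable is what permits inductions by conditioning on the first
step of the autoregression. -/
theorem map_consSeq_noise :
    ((gaussianReal 0 1).prod noise).map (fun p => consSeq p.1 p.2) = noise := by
  refine Measure.eq_infinitePi _ fun s t ht => ?_
  classical
  -- Filling the unconstrained coordinates with the whole line lets the cylinder be based on an
  -- initial segment, where the shift of indices is harmless.
  set t' : ℕ → Set ℝ := fun i => if i ∈ s then t i else Set.univ with ht'
  have hm : ∀ i, MeasurableSet (t' i) := fun i => by
    simp only [ht']; split_ifs
    exacts [ht i, .univ]
  obtain ⟨k, hk⟩ := s.exists_nat_subset_range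
  have hpre : (fun p : ℝ × (ℕ → ℝ) => consSeq p.1 p.2) ⁻¹' (Set.pi s t) =
      t' 0 ×ˢ Set.pi (Finset.range k : Set ℕ) (fun i => t' (i + 1)) := by
    ext ⟨a, v⟩
    simp only [Set.mem_preimage, Set.mem_pi, Set.mem_prod, ht', Finset.mem_coe]
    constructor
    · intro h
      refine ⟨?_, fun i _ => ?_⟩
      · split_ifs with h0
        exacts [h 0 h0, trivial]
      · split_ifs with h0
        exacts [h (i + 1) h0, trivial]
    · rintro ⟨h0, h1⟩ i hi
      cases i with
      | zero => simpa [hi] using h0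
      | succ i =>
        have := h1 i (by have := hk hi; simp at this ⊢; omega)
        simpa [hi] using this
  rw [Measure.map_apply measurable_consSeq
    (MeasurableSet.pi s.countable_toSet fun i _ => ht i), hpre, Measure.prod_prod, noise,
    Measure.infinitePi_pi _ (fun i _ => hm _), mul_comm,
    ← Finset.prod_range_succ' (fun i => gaussianReal 0 1 (t' i)) k]
  have hs : s ⊆ Finset.range (k + 1) := fun i hi => by
    have := hk hi; simp at this ⊢; omega
  rw [← Finset.prod_subset hs (f := fun i => gaussianReal 0 1 (t' i))]
  · exact Finset.prod_congr rfl fun i hi => by simp [ht', hi]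
  · intro i _ hi
    simp [ht', hi]

theorem lintegral_noise {F : (ℕ → ℝ) → ℝ≥0∞} (hF : Measurable F) :
    ∫⁻ v, F v ∂noise = ∫⁻ a, ∫⁻ v, F (consSeq a v) ∂noise ∂gaussianReal 0 1 := by
  conv_lhs => rw [← map_consSeq_noise]
  rw [lintegral_map hF measurable_consSeq,
    lintegral_prod (fun p : ℝ × (ℕ → ℝ) => F (consSeq p.1 p.2))
      (hF.comp measurable_consSeq).aemeasurable]

/-! ### Gaussian shifts -/

theorem lintegral_gaussian_shift (μ : ℝ) {K : ℝ → ℝ≥0∞} (hK : Measurable K) :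
    ∫⁻ a, K (μ + a) ∂gaussianReal 0 1 = ∫⁻ b, K b * gaussianPDF μ 1 b := by
  rw [← lintegral_map (f := K) (g := fun a => μ + a) hK (by fun_prop), gaussianReal_map_const_add,
    zero_add, gaussianReal_of_var_ne_zero _ one_ne_zero,
    lintegral_withDensity_eq_lintegral_mul _ (measurable_gaussianPDF _ _) hK]
  simp [mul_comm]

/-- One step of the likelihood computation: the density of `N(μ, 1)` relative to `N(0, 1)` at `b` is
`exp (μ b - μ² / 2)`. -/
theorem lintegral_gaussian_girsanov (μ : ℝ) {K : ℝ → ℝ≥0∞} (hK : Measurable K) :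
    ∫⁻ a, K (μ + a) ∂gaussianReal 0 1 =
      ∫⁻ b, K b * ENNReal.ofReal (Real.exp (μ * b - μ ^ 2 / 2)) ∂gaussianReal 0 1 := by
  have h := lintegral_gaussian_shift 0 (K := fun b => K b *
    ENNReal.ofReal (Real.exp (μ * b - μ ^ 2 / 2))) (by fun_prop)
  simp only [zero_add] at h
  rw [lintegral_gaussian_shift μ hK, h]
  refine lintegral_congr fun b => ?_
  rw [mul_assoc, gaussianPDF, gaussianPDF, ← ENNReal.ofReal_mul (Real.exp_pos _).le]
  congr 2
  simp only [gaussianPDFReal, NNReal.coe_one, mul_one, sub_zero]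
  rw [mul_left_comm, ← Real.exp_add]
  congr 2
  ring

theorem gaussianPDF_le_one (μ b : ℝ) : gaussianPDF μ 1 b ≤ 1 := by
  rw [gaussianPDF, ← ENNReal.ofReal_one]
  refine ENNReal.ofReal_le_ofReal ?_
  simp only [gaussianPDFReal, NNReal.coe_one, mul_one]
  have h1 : 1 ≤ √(2 * Real.pi) := by
    rw [Real.one_le_sqrt]; nlinarith [Real.pi_gt_three]
  have h2 : Real.exp (-(b - μ) ^ 2 / 2) ≤ 1 := by
    rw [Real.exp_le_one_iff]; nlinarith [sq_nonneg (b - μ)]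
  calc _ ≤ (1 : ℝ) * 1 := mul_le_mul (inv_le_one_of_one_le₀ h1) h2 (Real.exp_pos _).le zero_le_one
    _ = 1 := one_mul 1

theorem gaussianPDF_two_le {μ b : ℝ} (h : |b - μ| ≤ 2) :
    gaussianPDF 0 1 2 ≤ gaussianPDF μ 1 b := by
  refine ENNReal.ofReal_le_ofReal ?_
  simp only [gaussianPDFReal, NNReal.coe_one, mul_one, sub_zero]
  refine mul_le_mul_of_nonneg_left (Real.exp_le_exp.2 ?_) (by positivity)
  have := abs_le.1 h
  nlinarith

/-! ### The recursion -/

theorem measurable_pushLag {n : ℕ} : Measurable fun p : ℝ × (Fin n → ℝ) => pushLag p.1 p.2 := by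
  refine measurable_pi_lambda _ fun i => ?_
  unfold pushLag
  split_ifs
  · exact measurable_fst
  · exact (measurable_pi_apply _).comp measurable_snd

theorem measurable_lagState {n : ℕ} {m : (Fin n → ℝ) → ℝ} (hm : Measurable m) (t : ℕ) :
    Measurable fun ω : Sample n => lagState m ω t := by
  induction t with
  | zero => exact measurable_fst
  | succ t ih =>
    exact measurable_pushLag.comp (((hm.comp ih).add
      ((measurable_pi_apply t).comp measurable_snd)).prodMk ih)

theorem measurable_observations {n : ℕ} {m : (Fin n → ℝ) → ℝ} (hm : Measurable m) (T : ℕ) :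
    Measurable (observations m T) := by
  refine measurable_pi_lambda _ fun t => ?_
  exact ((hm.comp (measurable_lagState hm t)).add
      ((measurable_pi_apply (t : ℕ)).comp measurable_snd)).prodMk (measurable_lagState hm t)

/-- The Markov property in pathwise form: after one step the recursion restarts from the new lag
vector with the shifted noise. -/
theorem lagState_consSeq {n : ℕ} (m : (Fin n → ℝ) → ℝ) (x : Fin n → ℝ) (a : ℝ) (v : ℕ → ℝ)
    (t : ℕ) :
    lagState m (x, consSeq a v) (t + 1) = lagState m (pushLag (m x + a) x, v) t := by
  induction t with
  | zero => rfl
  | succ t ih => rw [lagState, ih]; rfl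

theorem observations_consSeq {n : ℕ} (m : (Fin n → ℝ) → ℝ) (x : Fin n → ℝ) (a : ℝ) (v : ℕ → ℝ)
    (T : ℕ) :
    observations m (T + 1) (x, consSeq a v) =
      (Fin.cons (m x + a, x) (observations m T (pushLag (m x + a) x, v)) :
        Fin (T + 1) → ℝ × (Fin n → ℝ)) := by
  funext t
  refine Fin.cases ?_ (fun t => ?_) t
  · rfl
  · simp only [Fin.cons_succ, observations, response, Fin.val_succ, lagState_consSeq, consSeq_succ]

/-! ### The likelihood -/

/-- The logarithm of the likelihood of the data under `m`, relative to `m = 0`. -/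
noncomputable def logLik {n : ℕ} (m : (Fin n → ℝ) → ℝ) (T : ℕ) (o : Fin T → ℝ × (Fin n → ℝ)) : ℝ :=
  ∑ t, (m (o t).2 * (o t).1 - m (o t).2 ^ 2 / 2)

theorem measurable_logLik {n : ℕ} {m : (Fin n → ℝ) → ℝ} (hm : Measurable m) (T : ℕ) :
    Measurable (logLik m T) := by
  unfold logLik
  fun_prop

theorem measurable_cons {α : Type*} [MeasurableSpace α] (T : ℕ) :
    Measurable fun p : α × (Fin T → α) => (Fin.cons p.1 p.2 : Fin (T + 1) → α) := by
  refine measurable_pi_lambda _ fun t => ?_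
  refine Fin.cases ?_ (fun t => ?_) t
  · exact measurable_fst
  · simp only [Fin.cons_succ]
    exact (measurable_pi_apply t).comp measurable_snd

/-- A change of measure with the starting point held fixed, so the law of the initial vector never
enters the likelihood. Each step contributes one Gaussian shift by `m` of the current lag vector. -/
theorem lintegral_observations {n : ℕ} {m : (Fin n → ℝ) → ℝ} (hm : Measurable m) (T : ℕ)
    (x : Fin n → ℝ) {H : (Fin T → ℝ × (Fin n → ℝ)) → ℝ≥0∞} (hH : Measurable H) :
    ∫⁻ v, H (observations m T (x, v)) ∂noise =
      ∫⁻ v, H (observations 0 T (x, v)) *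
        ENNReal.ofReal (Real.exp (logLik m T (observations 0 T (x, v)))) ∂noise := by
  induction T generalizing x with
  | zero =>
    refine lintegral_congr fun v => ?_
    rw [Subsingleton.elim (observations m 0 (x, v)) (observations 0 0 (x, v))]
    simp [logLik]
  | succ T ih =>
    have h0 : Measurable (0 : (Fin n → ℝ) → ℝ) := measurable_const
    have hL : Measurable fun o => H o * ENNReal.ofReal (Real.exp (logLik m (T + 1) o)) :=
      hH.mul (measurable_logLik hm _).exp.ennreal_ofReal
    have hc : ∀ b : ℝ, Measurable fun o : Fin T → ℝ × (Fin n → ℝ) =>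
        H (Fin.cons (b, x) o : Fin (T + 1) → ℝ × (Fin n → ℝ)) := fun b =>
      hH.comp ((measurable_cons T).comp (measurable_const.prodMk measurable_id))
    -- `K b` is the value given first response `b`, with the later steps already reweighted; only
    -- the shift of `b` by `m x` remains.
    set K : ℝ → ℝ≥0∞ := fun b => ∫⁻ v, H (Fin.cons (b, x) (observations 0 T (pushLag b x, v)) :
        Fin (T + 1) → ℝ × (Fin n → ℝ)) *
      ENNReal.ofReal (Real.exp (logLik m T (observations 0 T (pushLag b x, v)))) ∂noise with hK
    have hobs : Measurable fun p : ℝ × (ℕ → ℝ) => observations (0 : (Fin n → ℝ) → ℝ) T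
        (pushLag p.1 x, p.2) := (measurable_observations h0 T).comp
      ((measurable_pushLag.comp (measurable_fst.prodMk measurable_const)).prodMk measurable_snd)
    have hKm : Measurable K := by
      refine Measurable.lintegral_prod_right' (f := fun p : ℝ × (ℕ → ℝ) =>
        H (Fin.cons (p.1, x) (observations 0 T (pushLag p.1 x, p.2)) :
          Fin (T + 1) → ℝ × (Fin n → ℝ)) *
        ENNReal.ofReal (Real.exp (logLik m T (observations 0 T (pushLag p.1 x, p.2))))) ?_
      exact (hH.comp ((measurable_cons T).comp
        ((measurable_fst.prodMk measurable_const).prodMk hobs))).mul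
        ((measurable_logLik hm T).comp hobs).exp.ennreal_ofReal
    have hx : ∀ m : (Fin n → ℝ) → ℝ, Measurable m → Measurable fun v : ℕ → ℝ =>
        observations m (T + 1) (x, v) := fun m hm =>
      (measurable_observations hm _).comp (measurable_const.prodMk measurable_id)
    rw [lintegral_noise (F := fun v => H (observations m (T + 1) (x, v))) (hH.comp (hx m hm)),
      lintegral_noise (F := fun v => H (observations 0 (T + 1) (x, v)) *
        ENNReal.ofReal (Real.exp (logLik m (T + 1) (observations 0 (T + 1) (x, v)))))
        (hL.comp (hx 0 h0))]
    simp only [observations_consSeq]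
    calc _ = ∫⁻ a, K (m x + a) ∂gaussianReal 0 1 :=
          lintegral_congr fun a => ih _ (hc _)
      _ = _ := by
        rw [lintegral_gaussian_girsanov _ hKm]
        refine lintegral_congr fun b => ?_
        rw [hK, ← lintegral_mul_const'' _ (by
          refine Measurable.aemeasurable ?_
          have : Measurable fun v : ℕ → ℝ => (b, v) := by fun_prop
          exact ((hc b).comp (hobs.comp this)).mul
            ((measurable_logLik hm T).comp (hobs.comp this)).exp.ennreal_ofReal)]
        refine lintegral_congr fun v => ?_
        simp only [Pi.zero_apply, zero_add]
        rw [mul_assoc, ← ENNReal.ofReal_mul (Real.exp_pos _).le, ← Real.exp_add]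
        congr 3
        simp only [logLik, Fin.sum_univ_succ, Fin.cons_zero, Fin.cons_succ]
        ring_nf
/-! ### Testing two mean functions -/

/-- With `s - r` fixed, the weighted sum of squares is smallest at `(s - r)² a b / (a + b)`. The
square `(4 e - (a + b))² ≥ 0` then replaces this harmonic mean by an expression linear in `e` and `a
+ b`, ready to be integrated. -/
theorem two_point_pointwise {a b e s r : ℝ} (ha : 0 < a) (hb : 0 < b) (hab : e ^ 2 = a * b) :
    (s - r) ^ 2 / 2 * e ≤ s ^ 2 * a + r ^ 2 * b + (s - r) ^ 2 / 16 * (a + b) := by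
  have h1 : (s - r) ^ 2 * (a * b / (a + b)) ≤ s ^ 2 * a + r ^ 2 * b := by
    rw [← mul_div_assoc, div_le_iff₀ (by positivity)]
    nlinarith [sq_nonneg (a * s + b * r)]
  have h2 : e / 2 ≤ a * b / (a + b) + (a + b) / 16 := by
    rw [← hab, ← sub_nonneg]
    have : e ^ 2 / (a + b) + (a + b) / 16 - e / 2 = (4 * e - (a + b)) ^ 2 / (16 * (a + b)) := by
      field_simp; ring
    rw [this]; positivity
  nlinarith [mul_le_mul_of_nonneg_left h2 (sq_nonneg (s - r))]

/-- The terms linear in the responses average exactly; the quadratic ones differ by `(m₀² + m₁²) / 4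
- ((m₀ + m₁) / 2)² / 2 = (m₀ - m₁)² / 8`. -/
theorem logLik_add_logLik {n : ℕ} (m₀ m₁ : (Fin n → ℝ) → ℝ) (T : ℕ)
    (o : Fin T → ℝ × (Fin n → ℝ)) :
    (logLik m₀ T o + logLik m₁ T o) / 2 = -((∑ t, (m₀ (o t).2 - m₁ (o t).2) ^ 2) / 8) +
      logLik (fun x => (m₀ x + m₁ x) / 2) T o := by
  simp only [logLik]
  rw [← Finset.sum_add_distrib, Finset.sum_div, Finset.sum_div, ← Finset.sum_neg_distrib,
    ← Finset.sum_add_distrib]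
  refine Finset.sum_congr rfl fun t _ => ?_
  ring

/-- The pointwise inequality is integrated against both likelihoods, each of total mass `1`.
Affinity at least `3/4` leaves `(1/2)(3/4) - 2/16 = 1/4` of the squared gap. Since the squared loss
is bounded below directly, `h` need not be bounded. -/
theorem two_point {n : ℕ} {m₀ m₁ : (Fin n → ℝ) → ℝ} (hm₀ : Measurable m₀) (hm₁ : Measurable m₁)
    (T : ℕ) (x : Fin n → ℝ)
    (hD : ∫⁻ v, ENNReal.ofReal (∑ t : Fin T,
      (m₀ (lagState (fun x => (m₀ x + m₁ x) / 2) (x, v) t) -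
        m₁ (lagState (fun x => (m₀ x + m₁ x) / 2) (x, v) t)) ^ 2) ∂noise ≤ 2)
    {h : (Fin T → ℝ × (Fin n → ℝ)) → ℝ} (hh : Measurable h) (a₀ a₁ : ℝ) :
    ENNReal.ofReal ((a₀ - a₁) ^ 2 / 4) ≤
      ∫⁻ v, ENNReal.ofReal ((h (observations m₀ T (x, v)) - a₀) ^ 2) ∂noise +
      ∫⁻ v, ENNReal.ofReal ((h (observations m₁ T (x, v)) - a₁) ^ 2) ∂noise := by
  set mid : (Fin n → ℝ) → ℝ := fun x => (m₀ x + m₁ x) / 2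
  have hmm : Measurable mid := by fun_prop
  set D : (Fin T → ℝ × (Fin n → ℝ)) → ℝ := fun o => ∑ t, (m₀ (o t).2 - m₁ (o t).2) ^ 2
  have hDm : Measurable D := by fun_prop
  have hl₀ := measurable_logLik hm₀ T
  have hl₁ := measurable_logLik hm₁ T
  have hobs : ∀ m : (Fin n → ℝ) → ℝ, Measurable m → Measurable fun v : ℕ → ℝ =>
      observations m T (x, v) := fun m hm =>
    (measurable_observations hm _).comp (measurable_const.prodMk measurable_id)
  have h0 := hobs 0 measurable_const
  have hone : ∀ m : (Fin n → ℝ) → ℝ, Measurable m →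
      ∫⁻ v, ENNReal.ofReal (Real.exp (logLik m T (observations 0 T (x, v)))) ∂noise = 1 := by
    intro m hm
    have := lintegral_observations hm T x (H := fun _ => 1) measurable_const
    simpa using this.symm
  -- The affinity equals the mean of `exp (-D / 8)` under `mid`; now `exp (-z) ≥ 1 - z` and the
  -- assumed bound `2` on the mean of `D` give `1 - 2/8`.
  have haff : 3 / 4 ≤ ∫⁻ v, ENNReal.ofReal (Real.exp ((logLik m₀ T (observations 0 T (x, v)) +
      logLik m₁ T (observations 0 T (x, v))) / 2)) ∂noise := by
    have h1 := lintegral_observations hmm T x (H := fun o => ENNReal.ofReal (Real.exp (-(D o / 8))))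
      (by fun_prop)
    have h2 : ∫⁻ v, ENNReal.ofReal (Real.exp ((logLik m₀ T (observations 0 T (x, v)) +
        logLik m₁ T (observations 0 T (x, v))) / 2)) ∂noise =
        ∫⁻ v, ENNReal.ofReal (Real.exp (-(D (observations mid T (x, v)) / 8))) ∂noise := by
      rw [h1]
      refine lintegral_congr fun v => ?_
      rw [← ENNReal.ofReal_mul (Real.exp_pos _).le, ← Real.exp_add, logLik_add_logLik]
    rw [h2]
    have h3 : (1 : ℝ≥0∞) ≤ ∫⁻ v, ENNReal.ofReal (Real.exp (-(D (observations mid T (x, v)) / 8)))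
        ∂noise + ∫⁻ v, ENNReal.ofReal (1 / 8) * ENNReal.ofReal (D (observations mid T (x, v)))
        ∂noise := by
      rw [← lintegral_add_left (by have := hobs mid hmm; fun_prop)]
      calc (1 : ℝ≥0∞) = ∫⁻ _, 1 ∂noise := by simp
        _ ≤ _ := by
          refine lintegral_mono fun v => ?_
          have hD0 : 0 ≤ D (observations mid T (x, v)) :=
            Finset.sum_nonneg fun _ _ => sq_nonneg _
          rw [← ENNReal.ofReal_mul (by norm_num), ← ENNReal.ofReal_add (Real.exp_pos _).le
            (by positivity), ← ENNReal.ofReal_one]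
          refine ENNReal.ofReal_le_ofReal ?_
          have := Real.add_one_le_exp (-(D (observations mid T (x, v)) / 8))
          linarith
    rw [lintegral_const_mul' _ _ ENNReal.ofReal_ne_top] at h3
    have h4 := h3.trans (add_le_add_right (mul_le_mul_right hD _) _)
    have h5 : ENNReal.ofReal (1 / 8) * 2 = 1 / 4 := by
      rw [← ENNReal.ofReal_ofNat 2, ← ENNReal.ofReal_mul (by norm_num), ← ENNReal.ofReal_one,
        ← ENNReal.ofReal_ofNat 4, ← ENNReal.ofReal_div_of_pos (by norm_num)]
      norm_num
    rw [h5] at h4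
    have h6 : (3 : ℝ≥0∞) / 4 + 1 / 4 = 1 := by
      rw [← ENNReal.add_div]
      norm_num
      exact ENNReal.div_self (by norm_num) (by norm_num)
    exact (ENNReal.add_le_add_iff_right (ENNReal.div_ne_top ENNReal.one_ne_top
      (by norm_num : (4 : ℝ≥0∞) ≠ 0))).1 (h6.trans_le h4)
  set E : ℝ≥0∞ := ∫⁻ v, ENNReal.ofReal (Real.exp ((logLik m₀ T (observations 0 T (x, v)) +
      logLik m₁ T (observations 0 T (x, v))) / 2)) ∂noise
  rw [lintegral_observations hm₀ T x (H := fun o => ENNReal.ofReal ((h o - a₀) ^ 2)) (by fun_prop),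
    lintegral_observations hm₁ T x (H := fun o => ENNReal.ofReal ((h o - a₁) ^ 2)) (by fun_prop)]
  set R₀ := ∫⁻ v, ENNReal.ofReal ((h (observations 0 T (x, v)) - a₀) ^ 2) *
    ENNReal.ofReal (Real.exp (logLik m₀ T (observations 0 T (x, v)))) ∂noise
  set R₁ := ∫⁻ v, ENNReal.ofReal ((h (observations 0 T (x, v)) - a₁) ^ 2) *
    ENNReal.ofReal (Real.exp (logLik m₁ T (observations 0 T (x, v)))) ∂noise
  have key : ENNReal.ofReal ((a₀ - a₁) ^ 2 / 2) * E ≤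
      (R₀ + R₁) + ENNReal.ofReal ((a₀ - a₁) ^ 2 / 16) * (1 + 1) := by
    nth_rewrite 1 [← hone m₀ hm₀]
    rw [← hone m₁ hm₁, ← lintegral_add_left (by fun_prop), ← lintegral_add_left (by fun_prop),
      ← lintegral_const_mul' _ _ ENNReal.ofReal_ne_top,
      ← lintegral_const_mul' _ _ ENNReal.ofReal_ne_top, ← lintegral_add_left (by fun_prop)]
    refine lintegral_mono fun v => ?_
    have hp := two_point_pointwise (s := h (observations 0 T (x, v)) - a₀)
      (r := h (observations 0 T (x, v)) - a₁)
      (Real.exp_pos (logLik m₀ T (observations 0 T (x, v))))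
      (Real.exp_pos (logLik m₁ T (observations 0 T (x, v))))
      (e := Real.exp ((logLik m₀ T (observations 0 T (x, v)) +
        logLik m₁ T (observations 0 T (x, v))) / 2))
      (by rw [← Real.exp_add, ← Real.exp_nat_mul]; congr 1; push_cast; ring)
    have e1 : h (observations 0 T (x, v)) - a₀ - (h (observations 0 T (x, v)) - a₁) = -(a₀ - a₁) :=
      by ring
    rw [e1, neg_sq] at hp
    rw [← ENNReal.ofReal_mul (by positivity), ← ENNReal.ofReal_mul (by positivity),
      ← ENNReal.ofReal_mul (by positivity), ← ENNReal.ofReal_add (by positivity) (by positivity),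
      ← ENNReal.ofReal_add (by positivity) (by positivity), ← ENNReal.ofReal_mul (by positivity),
      ← ENNReal.ofReal_add (by positivity) (by positivity)]
    exact ENNReal.ofReal_le_ofReal hp
  have h7 := (mul_le_mul_right haff (ENNReal.ofReal ((a₀ - a₁) ^ 2 / 2))).trans key
  have h8 : ENNReal.ofReal ((a₀ - a₁) ^ 2 / 2) * (3 / 4) =
      ENNReal.ofReal ((a₀ - a₁) ^ 2 / 4) + ENNReal.ofReal ((a₀ - a₁) ^ 2 / 8) := by
    rw [← ENNReal.ofReal_ofNat 3, ← ENNReal.ofReal_ofNat 4,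
      ← ENNReal.ofReal_div_of_pos (by norm_num), ← ENNReal.ofReal_mul (by positivity),
      ← ENNReal.ofReal_add (by positivity) (by positivity)]
    congr 1; ring
  have h9 : ENNReal.ofReal ((a₀ - a₁) ^ 2 / 16) * (1 + 1) = ENNReal.ofReal ((a₀ - a₁) ^ 2 / 8) := by
    rw [one_add_one_eq_two, ← ENNReal.ofReal_ofNat 2, ← ENNReal.ofReal_mul (by positivity)]
    congr 1; ring
  rw [h8, h9] at h7
  exact (ENNReal.add_le_add_iff_right ENNReal.ofReal_ne_top).1 h7

/-! ### The occupation measure -/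

/-- The lag vector after `k` steps from `x`, the values in these steps being `y`. -/
def mergeLag {n : ℕ} (k : ℕ) (y : Fin k → ℝ) (x : Fin n → ℝ) : Fin n → ℝ :=
  fun i => if h : (i : ℕ) < k then y ⟨i, h⟩ else x ⟨(i : ℕ) - k, by omega⟩

theorem mergeLag_zero {n : ℕ} (y : Fin 0 → ℝ) (x : Fin n → ℝ) : mergeLag 0 y x = x := by
  funext i; simp [mergeLag]

theorem mergeLag_self {n : ℕ} (y : Fin n → ℝ) (x : Fin n → ℝ) : mergeLag n y x = y := by
  funext i; simp [mergeLag]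

/-- New values enter at index `0`, so the first one drawn, `b`, ends up as the oldest of the `k + 1`
recent ones; hence `Fin.snoc`. -/
theorem mergeLag_pushLag {n k : ℕ} (y : Fin k → ℝ) (b : ℝ) (x : Fin n → ℝ) :
    mergeLag k y (pushLag b x) = mergeLag (k + 1) (Fin.snoc y b : Fin (k + 1) → ℝ) x := by
  funext i
  simp only [mergeLag, pushLag, Fin.snoc]
  rcases lt_trichotomy (i : ℕ) k with h | h | h
  · simp [h, h.trans k.lt_succ_self]
  · simp [h]
  · have h1 : ¬ (i : ℕ) < k := by omega
    have h2 : ¬ (i : ℕ) < k + 1 := by omega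
    have h3 : ¬ (i : ℕ) - k = 0 := by omega
    simp only [h1, h2, h3, dite_false, if_false]
    congr 1

theorem measurable_mergeLag {n : ℕ} (k : ℕ) :
    Measurable fun p : (Fin k → ℝ) × (Fin n → ℝ) => mergeLag k p.1 p.2 := by
  refine measurable_pi_lambda _ fun i => ?_
  unfold mergeLag
  split_ifs <;> fun_prop

theorem lintegral_mergeLag_succ {n : ℕ} (ρ : Measure ℝ) [SigmaFinite ρ] (k : ℕ)
    {g : (Fin n → ℝ) → ℝ≥0∞} (hg : Measurable g) (x : Fin n → ℝ) :
    ∫⁻ y, g (mergeLag (k + 1) y x) ∂Measure.pi (fun _ => ρ) =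
      ∫⁻ b, ∫⁻ y, g (mergeLag k y (pushLag b x)) ∂Measure.pi (fun _ => ρ) ∂ρ := by
  have h := ((measurePreserving_piFinSuccAbove (fun _ : Fin (k + 1) => ρ) (Fin.last k)).symm).lintegral_comp
    (f := fun y => g (mergeLag (k + 1) y x))
    (hg.comp ((measurable_mergeLag _).comp (measurable_id.prodMk measurable_const)))
  rw [← h]
  have hm : Measurable fun p : ℝ × (Fin k → ℝ) => g (mergeLag k p.2 (pushLag p.1 x)) :=
    hg.comp ((measurable_mergeLag k).comp (measurable_snd.prodMk
      (measurable_pushLag.comp (measurable_fst.prodMk measurable_const))))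
  rw [← lintegral_prod _ hm.aemeasurable]
  refine lintegral_congr fun p => ?_
  rw [mergeLag_pushLag]
  congr 2
  simp [MeasurableEquiv.piFinSuccAbove, Fin.insertNthEquiv]

theorem measurable_lintegral_mergeLag {n : ℕ} (ρ : Measure ℝ) [SigmaFinite ρ] (k : ℕ)
    {g : (Fin n → ℝ) → ℝ≥0∞} (hg : Measurable g) (x : Fin n → ℝ) :
    Measurable fun b => ∫⁻ y, g (mergeLag k y (pushLag b x)) ∂Measure.pi (fun _ => ρ) :=
  Measurable.lintegral_prod_right' (f := fun p : ℝ × (Fin k → ℝ) =>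
    g (mergeLag k p.2 (pushLag p.1 x))) (hg.comp ((measurable_mergeLag k).comp
      (measurable_snd.prodMk (measurable_pushLag.comp (measurable_fst.prodMk measurable_const)))))

theorem measurable_lagState_right {n : ℕ} {m : (Fin n → ℝ) → ℝ} (hm : Measurable m)
    (x : Fin n → ℝ) (t : ℕ) : Measurable fun v : ℕ → ℝ => lagState m (x, v) t :=
  (measurable_lagState hm t).comp (measurable_const.prodMk measurable_id)

theorem lintegral_lagState_succ {n : ℕ} {m : (Fin n → ℝ) → ℝ} (hm : Measurable m) (k : ℕ)
    {g : (Fin n → ℝ) → ℝ≥0∞} (hg : Measurable g) (x : Fin n → ℝ) :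
    ∫⁻ v, g (lagState m (x, v) (k + 1)) ∂noise =
      ∫⁻ a, ∫⁻ v, g (lagState m (pushLag (m x + a) x, v) k) ∂noise ∂gaussianReal 0 1 := by
  rw [lintegral_noise (F := fun v => g (lagState m (x, v) (k + 1)))
    (hg.comp (measurable_lagState_right hm x _))]
  simp only [lagState_consSeq]

theorem lintegral_lagState_ge_merge {n : ℕ} {m : (Fin n → ℝ) → ℝ} (hm : Measurable m)
    (hb : ∀ x, |m x| ≤ 1) (k : ℕ) {g : (Fin n → ℝ) → ℝ≥0∞} (hg : Measurable g) (x : Fin n → ℝ) :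
    gaussianPDF 0 1 2 ^ k * ∫⁻ y, g (mergeLag k y x)
      ∂Measure.pi (fun _ => volume.restrict (Set.Icc (0 : ℝ) 1)) ≤
        ∫⁻ v, g (lagState m (x, v) k) ∂noise := by
  induction k generalizing x with
  | zero => simp [mergeLag_zero, lagState]
  | succ k ih =>
    rw [lintegral_lagState_succ hm k hg, lintegral_mergeLag_succ _ k hg]
    set K : ℝ → ℝ≥0∞ := fun b => ∫⁻ y, g (mergeLag k y (pushLag b x))
      ∂Measure.pi (fun _ => volume.restrict (Set.Icc (0 : ℝ) 1))
    have hK : Measurable K := measurable_lintegral_mergeLag _ k hg x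
    calc _ = ∫⁻ b in Set.Icc (0 : ℝ) 1, gaussianPDF 0 1 2 ^ k * K b * gaussianPDF 0 1 2 := by
          rw [lintegral_mul_const _ (by fun_prop), lintegral_const_mul _ hK, pow_succ]
          ring
      _ ≤ ∫⁻ b in Set.Icc (0 : ℝ) 1, gaussianPDF 0 1 2 ^ k * K b * gaussianPDF (m x) 1 b := by
          refine setLIntegral_mono' measurableSet_Icc fun b hbI => ?_
          -- A mean in `[-1, 1]` and a value in `[0, 1]` are at distance at most `2`, whence the
          -- constant `gaussianPDF 0 1 2`.
          refine mul_le_mul_right (gaussianPDF_two_le ?_) _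
          have := abs_le.1 (hb x)
          rw [abs_le]; constructor <;> linarith [hbI.1, hbI.2]
      _ ≤ ∫⁻ b, gaussianPDF 0 1 2 ^ k * K b * gaussianPDF (m x) 1 b := setLIntegral_le_lintegral _ _
      _ = ∫⁻ a, gaussianPDF 0 1 2 ^ k * K (m x + a) ∂gaussianReal 0 1 :=
          (lintegral_gaussian_shift (m x) (K := fun b => gaussianPDF 0 1 2 ^ k * K b)
            (by fun_prop)).symm
      _ ≤ _ := lintegral_mono fun a => ih _

theorem lintegral_lagState_le_merge {n : ℕ} {m : (Fin n → ℝ) → ℝ} (hm : Measurable m)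
    (k : ℕ) {g : (Fin n → ℝ) → ℝ≥0∞} (hg : Measurable g) (x : Fin n → ℝ) :
    ∫⁻ v, g (lagState m (x, v) k) ∂noise ≤
      ∫⁻ y, g (mergeLag k y x) ∂Measure.pi (fun _ => (volume : Measure ℝ)) := by
  induction k generalizing x with
  | zero => simp [mergeLag_zero, lagState]
  | succ k ih =>
    rw [lintegral_lagState_succ hm k hg, lintegral_mergeLag_succ _ k hg]
    have hK : Measurable fun b => ∫⁻ y, g (mergeLag k y (pushLag b x))
        ∂Measure.pi (fun _ => (volume : Measure ℝ)) := measurable_lintegral_mergeLag _ k hg x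
    refine (lintegral_mono fun a => ih _).trans ?_
    rw [lintegral_gaussian_shift (m x) hK]
    exact lintegral_mono fun b => mul_le_of_le_one_right' (gaussianPDF_le_one _ _)

/-- After exactly `n` steps the starting vector has been entirely replaced, so the bound is uniform
in it; at later times it follows by conditioning on the first step. -/
theorem lintegral_lagState_ge {n : ℕ} {m : (Fin n → ℝ) → ℝ} (hm : Measurable m)
    (hb : ∀ x, |m x| ≤ 1) {t : ℕ} (ht : n ≤ t) {g : (Fin n → ℝ) → ℝ≥0∞} (hg : Measurable g)
    (x : Fin n → ℝ) :
    gaussianPDF 0 1 2 ^ n * ∫⁻ y in cube n 0 1, g y ≤ ∫⁻ v, g (lagState m (x, v) t) ∂noise := by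
  induction t, ht using Nat.le_induction generalizing x with
  | base =>
    refine le_of_eq_of_le ?_ (lintegral_lagState_ge_merge hm hb n hg x)
    simp only [mergeLag_self]
    rw [cube, ← Set.pi_univ_Icc, volume_pi, Measure.restrict_pi_pi]
  | succ t ht ih =>
    rw [lintegral_lagState_succ hm t hg]
    calc _ = ∫⁻ _, (gaussianPDF 0 1 2 ^ n * ∫⁻ y in cube n 0 1, g y) ∂gaussianReal 0 1 := by simp
      _ ≤ _ := lintegral_mono fun a => ih _

theorem lintegral_lagState_le {n : ℕ} {m : (Fin n → ℝ) → ℝ} (hm : Measurable m)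
    {t : ℕ} (ht : n ≤ t) {g : (Fin n → ℝ) → ℝ≥0∞} (hg : Measurable g) (x : Fin n → ℝ) :
    ∫⁻ v, g (lagState m (x, v) t) ∂noise ≤ ∫⁻ y, g y := by
  induction t, ht using Nat.le_induction generalizing x with
  | base =>
    refine (lintegral_lagState_le_merge hm n hg x).trans_eq ?_
    simp only [mergeLag_self]
    rfl
  | succ t ht ih =>
    rw [lintegral_lagState_succ hm t hg]
    calc _ ≤ ∫⁻ _, (∫⁻ y, g y) ∂gaussianReal 0 1 := lintegral_mono fun a => ih _
      _ = _ := by simp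

/-! ### Assouad's bound -/

instance {n : ℕ} (ν : Measure (Fin n → ℝ)) [IsProbabilityMeasure ν] :
    IsProbabilityMeasure (modelMeasure ν) := by unfold modelMeasure; infer_instance

theorem lintegral_modelMeasure {n : ℕ} (ν : Measure (Fin n → ℝ)) [IsProbabilityMeasure ν]
    {F : Sample n → ℝ≥0∞} (hF : Measurable F) :
    ∫⁻ ω, F ω ∂modelMeasure ν = ∫⁻ x, ∫⁻ v, F (x, v) ∂noise ∂ν :=
  lintegral_prod _ hF.aemeasurable

/-- Bounds uniform in the starting point survive any initial law, which is how an arbitrary `ν` is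
accommodated. -/
theorem le_lintegral_modelMeasure {n : ℕ} (ν : Measure (Fin n → ℝ)) [IsProbabilityMeasure ν]
    {F : Sample n → ℝ≥0∞} (hF : Measurable F) {C : ℝ≥0∞}
    (h : ∀ x, C ≤ ∫⁻ v, F (x, v) ∂noise) : C ≤ ∫⁻ ω, F ω ∂modelMeasure ν := by
  rw [lintegral_modelMeasure ν hF]
  calc C = ∫⁻ _, C ∂ν := by simp
    _ ≤ _ := lintegral_mono h

/-- At least half of the `T` times lie past the burn-in of length `n`. -/
theorem half_mul_le_average {n T : ℕ} (hT : 1 ≤ T) (hn : 2 * n ≤ T) {I : ℕ → ℝ≥0∞} {C : ℝ≥0∞}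
    (h : ∀ t, n ≤ t → C ≤ I t) :
    1 / 2 * C ≤ ENNReal.ofReal (1 / T) * ∑ t ∈ Finset.range T, I t := by
  have h1 : ((T - n : ℕ) : ℝ≥0∞) * C ≤ ∑ t ∈ Finset.range T, I t := by
    calc ((T - n : ℕ) : ℝ≥0∞) * C = ∑ t ∈ Finset.Ico n T, C := by simp
      _ ≤ ∑ t ∈ Finset.Ico n T, I t :=
        Finset.sum_le_sum fun t ht => h t (Finset.mem_Ico.1 ht).1
      _ ≤ _ := Finset.sum_le_sum_of_subset fun t ht =>
        Finset.mem_range.2 (Finset.mem_Ico.1 ht).2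
  refine le_trans ?_ (mul_le_mul_right h1 _)
  rw [← mul_assoc]
  refine mul_le_mul_left ?_ _
  have hT0 : (0 : ℝ) < T := by exact_mod_cast hT
  rw [← ENNReal.ofReal_natCast, ← ENNReal.ofReal_mul (by positivity), ← ENNReal.ofReal_one,
    ← ENNReal.ofReal_ofNat 2, ← ENNReal.ofReal_div_of_pos (by norm_num)]
  refine ENNReal.ofReal_le_ofReal ?_
  rw [Nat.cast_sub (by omega), div_mul_eq_mul_div, one_mul, le_div_iff₀ hT0]
  have : (2 : ℝ) * n ≤ T := by exact_mod_cast hn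
  linarith

theorem measurableSet_cube (n : ℕ) (l u : ℝ) : MeasurableSet (cube n l u) := measurableSet_Icc

/-- For fixed data, averaging over the independent copy integrates the squared error against
occupation laws whose density on the cube is bounded below; on the cube the target is `m` itself. -/
theorem le_risk {n : ℕ} (ν : Measure (Fin n → ℝ)) [IsProbabilityMeasure ν]
    {m : (Fin n → ℝ) → ℝ} (hm : Measurable m) (hb : ∀ x, |m x| ≤ 1) {T : ℕ} (hT : 1 ≤ T)
    (hn : 2 * n ≤ T) {f : (Fin T → ℝ × (Fin n → ℝ)) → (Fin n → ℝ) → ℝ} (hf : f ∈ estimators n T) :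
    1 / 2 * gaussianPDF 0 1 2 ^ n * ∫⁻ x in cube n 0 1, ∫⁻ ω,
      ENNReal.ofReal ((f (observations m T ω) x - m x) ^ 2) ∂modelMeasure ν ≤ risk ν m T f := by
  have hf' : Measurable (Function.uncurry f) := hf
  have htm : Measurable (target m) := hm.indicator (measurableSet_cube n 0 1)
  have hobs := measurable_observations hm T
  have hfo : ∀ t, Measurable fun ω : Sample n × Sample n =>
      (f (observations m T ω.1) (lagState m ω.2 t) - target m (lagState m ω.2 t)) ^ 2 := fun t =>
    ((hf'.comp ((hobs.comp measurable_fst).prodMk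
      ((measurable_lagState hm t).comp measurable_snd))).sub
      (htm.comp ((measurable_lagState hm t).comp measurable_snd))).pow_const 2
  have hfx : Measurable fun p : Sample n × (Fin n → ℝ) =>
      ENNReal.ofReal ((f (observations m T p.1) p.2 - m p.2) ^ 2) :=
    (((hf'.comp ((hobs.comp measurable_fst).prodMk measurable_snd)).sub
      (hm.comp measurable_snd)).pow_const 2).ennreal_ofReal
  rw [lintegral_lintegral_swap (f := fun x ω =>
      ENNReal.ofReal ((f (observations m T ω) x - m x) ^ 2)) (hfx.comp measurable_swap).aemeasurable,
    risk, lintegral_prod _ ((Finset.measurable_sum _ fun t _ => hfo t).const_mul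
      _).ennreal_ofReal.aemeasurable, ← lintegral_const_mul _ hfx.lintegral_prod_right']
  refine lintegral_mono fun ω => ?_
  set G : (Fin n → ℝ) → ℝ≥0∞ := fun x =>
    ENNReal.ofReal ((f (observations m T ω) x - target m x) ^ 2) with hG
  have hGm : Measurable G := by
    have : Measurable fun x => f (observations m T ω) x :=
      hf'.comp (measurable_const.prodMk measurable_id)
    fun_prop
  have e1 : ∫⁻ x in cube n 0 1, ENNReal.ofReal ((f (observations m T ω) x - m x) ^ 2) =
      ∫⁻ x in cube n 0 1, G x := by
    refine setLIntegral_congr_fun (measurableSet_cube n 0 1) fun x hx => ?_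
    simp only [hG, target, Set.indicator_of_mem hx]
  have e2 : ∫⁻ ω', ENNReal.ofReal (1 / (T : ℝ) * ∑ t ∈ Finset.range T,
      (f (observations m T ω) (lagState m ω' t) - target m (lagState m ω' t)) ^ 2) ∂modelMeasure ν =
      ENNReal.ofReal (1 / T) * ∑ t ∈ Finset.range T, ∫⁻ ω', G (lagState m ω' t) ∂modelMeasure ν := by
    rw [← lintegral_finsetSum (f := fun t ω' => G (lagState m ω' t)) _
        fun t _ => hGm.comp (measurable_lagState hm t),
      ← lintegral_const_mul' _ _ ENNReal.ofReal_ne_top]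
    refine lintegral_congr fun ω' => ?_
    rw [ENNReal.ofReal_mul (by positivity), ENNReal.ofReal_sum_of_nonneg fun _ _ => sq_nonneg _]
  simp only [e2]
  rw [mul_assoc, e1]
  refine half_mul_le_average hT hn fun t ht => ?_
  exact le_lintegral_modelMeasure ν (hGm.comp (measurable_lagState hm t)) fun x =>
    lintegral_lagState_ge hm hb ht hGm x

/-- Each of the first `n` times costs at most `δ²`, as nothing is known about the law of the start.
Each later time costs at most `δ²` times the volume of `J`, the density being at most `1`. -/
theorem lintegral_sum_sq_le {n : ℕ} {m m₀ m₁ : (Fin n → ℝ) → ℝ} (hm : Measurable m) {δ V : ℝ}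
    (hV : 0 ≤ V) {J : Set (Fin n → ℝ)} (hJ : MeasurableSet J)
    (hJV : volume J ≤ ENNReal.ofReal V) (hd : ∀ x, |m₀ x - m₁ x| ≤ δ)
    (hd' : ∀ x, x ∉ J → m₀ x = m₁ x) (T : ℕ) (hT : n * δ ^ 2 + T * (δ ^ 2 * V) ≤ 2)
    (x : Fin n → ℝ) :
    ∫⁻ v, ENNReal.ofReal (∑ t : Fin T,
      (m₀ (lagState m (x, v) t) - m₁ (lagState m (x, v) t)) ^ 2) ∂noise ≤ 2 := by
  set g : (Fin n → ℝ) → ℝ≥0∞ := J.indicator fun _ => ENNReal.ofReal (δ ^ 2) with hg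
  have hgm : Measurable g := measurable_const.indicator hJ
  have hle : ∀ y, ENNReal.ofReal ((m₀ y - m₁ y) ^ 2) ≤ g y := fun y => by
    by_cases hy : y ∈ J
    · rw [hg, Set.indicator_of_mem hy]
      exact ENNReal.ofReal_le_ofReal (sq_le_sq' (abs_le.1 (hd y)).1 (abs_le.1 (hd y)).2)
    · simp [hd' y hy]
  have hg1 : ∀ y, g y ≤ ENNReal.ofReal (δ ^ 2) := fun y => Set.indicator_le_self' (by simp) y
  calc _ ≤ ∫⁻ v, ∑ t ∈ Finset.range T, g (lagState m (x, v) t) ∂noise := by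
        refine lintegral_mono fun v => ?_
        rw [Finset.sum_range, ENNReal.ofReal_sum_of_nonneg fun _ _ => sq_nonneg _]
        exact Finset.sum_le_sum fun t _ => hle _
    _ = ∑ t ∈ Finset.range T, ∫⁻ v, g (lagState m (x, v) t) ∂noise :=
        lintegral_finsetSum _ fun t _ => hgm.comp (measurable_lagState_right hm x t)
    _ ≤ ∑ t ∈ Finset.range T, ((if t < n then ENNReal.ofReal (δ ^ 2) else 0) +
          ENNReal.ofReal (δ ^ 2 * V)) := by
        refine Finset.sum_le_sum fun t _ => ?_
        split_ifs with h
        · refine le_add_right ?_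
          calc _ ≤ ∫⁻ _, ENNReal.ofReal (δ ^ 2) ∂noise := lintegral_mono fun v => hg1 _
            _ = _ := by simp
        · rw [zero_add]
          refine (lintegral_lagState_le hm (not_lt.1 h) hgm x).trans ?_
          rw [hg, lintegral_indicator_const hJ, ENNReal.ofReal_mul (sq_nonneg δ)]
          exact mul_le_mul_right hJV _
    _ ≤ ENNReal.ofReal (n * δ ^ 2) + ENNReal.ofReal (T * (δ ^ 2 * V)) := by
        rw [Finset.sum_add_distrib]
        refine add_le_add ?_ ?_
        · rw [← Finset.sum_filter, Finset.sum_const, nsmul_eq_mul,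
            ENNReal.ofReal_mul (Nat.cast_nonneg n), ENNReal.ofReal_natCast]
          refine mul_le_mul_left ?_ _
          exact_mod_cast (Finset.card_le_card (t := Finset.range n) fun t ht => by
            simp at ht ⊢; exact ht.2).trans_eq (Finset.card_range n)
        · simp [ENNReal.ofReal_mul]
    _ = ENNReal.ofReal (n * δ ^ 2 + T * (δ ^ 2 * V)) :=
        (ENNReal.ofReal_add (by positivity) (by positivity)).symm
    _ ≤ 2 := by
        rw [← ENNReal.ofReal_ofNat 2]
        exact ENNReal.ofReal_le_ofReal hT

/-- `I u` is where the bit `u` can be read off the mean function, `J u` the larger set where it has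
any influence. At fixed `x ∈ I u` the estimator is a guess of one number, so `two_point` applies to
each `w` and its flip at `u`; averaging over all `w` bounds the supremum. -/
theorem assouad {n : ℕ} (ν : Measure (Fin n → ℝ)) [IsProbabilityMeasure ν]
    (M : Set ((Fin n → ℝ) → ℝ)) {T : ℕ} (hT : 1 ≤ T) (hn : 2 * n ≤ T)
    {ι : Type*} [Fintype ι] [DecidableEq ι] (m : (ι → Bool) → (Fin n → ℝ) → ℝ)
    (hmM : ∀ w, m w ∈ M) (hm : ∀ w, Measurable (m w)) (hb : ∀ w x, |m w x| ≤ 1)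
    (I J : ι → Set (Fin n → ℝ)) (hI : ∀ u, MeasurableSet (I u)) (hJ : ∀ u, MeasurableSet (J u))
    (hIc : ∀ u, I u ⊆ cube n 0 1) (hId : Pairwise (Function.onFun Disjoint I))
    {δ V : ℝ} {V' : ℝ≥0∞} (hV : 0 ≤ V)
    (hIV : ∀ u, V' ≤ volume (I u)) (hJV : ∀ u, volume (J u) ≤ ENNReal.ofReal V)
    (hval : ∀ w u, ∀ x ∈ I u, m w x = if w u then δ else 0)
    (hd : ∀ w w' x, |m w x - m w' x| ≤ δ)
    (hd' : ∀ w u b x, x ∉ J u → m w x = m (Function.update w u b) x)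
    (hsum : n * δ ^ 2 + T * (δ ^ 2 * V) ≤ 2) :
    1 / 2 * gaussianPDF 0 1 2 ^ n * (Fintype.card ι * (V' * ENNReal.ofReal (δ ^ 2 / 8))) ≤
      minimaxRisk ν M T := by
  refine le_iInf₂ fun f hf => ?_
  have hf' : Measurable (Function.uncurry f) := hf
  set S : ℝ≥0∞ := ⨆ m ∈ M, risk ν m T f with hS
  set R : (ι → Bool) → (Fin n → ℝ) → ℝ≥0∞ := fun w x => ∫⁻ ω,
      ENNReal.ofReal ((f (observations (m w) T ω) x - m w x) ^ 2) ∂modelMeasure ν with hR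
  have hRm : ∀ w, Measurable (R w) := fun w => by
    refine Measurable.lintegral_prod_left' (f := fun p : Sample n × (Fin n → ℝ) =>
      ENNReal.ofReal ((f (observations (m w) T p.1) p.2 - m w p.2) ^ 2)) ?_
    exact (((hf'.comp (((measurable_observations (hm w) T).comp measurable_fst).prodMk
      measurable_snd)).sub ((hm w).comp measurable_snd)).pow_const 2).ennreal_ofReal
  set flip : ι → (ι → Bool) → (ι → Bool) := fun u w => Function.update w u (!w u) with hflip
  have hinv : ∀ u, Function.Involutive (flip u) := fun u w => by
    funext i
    by_cases h : i = u
    · subst h; simp [hflip]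
    · simp [hflip, h]
  have hpair : ∀ w u, ∀ x ∈ I u, ENNReal.ofReal (δ ^ 2 / 4) ≤ R w x + R (flip u w) x := by
    intro w u x hx
    have hfx : ∀ w, Measurable fun ω => ENNReal.ofReal
        ((f (observations (m w) T ω) x - m w x) ^ 2) := fun w =>
      (((hf'.comp ((measurable_observations (hm w) T).prodMk
        measurable_const)).sub measurable_const).pow_const 2).ennreal_ofReal
    simp only [hR]
    rw [← lintegral_add_left (hfx w)]
    refine le_lintegral_modelMeasure ν ((hfx w).add (hfx _)) fun x₀ => ?_
    simp only [Pi.add_apply]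
    rw [lintegral_add_left (f := fun v => ENNReal.ofReal
      ((f (observations (m w) T (x₀, v)) x - m w x) ^ 2))
      ((hfx w).comp (measurable_const.prodMk measurable_id))]
    have hmid : Measurable fun x => (m w x + m (flip u w) x) / 2 :=
      ((hm w).add (hm _)).div_const 2
    have h := two_point (hm w) (hm (flip u w)) T x₀
      (lintegral_sum_sq_le hmid hV (hJ u) (hJV u) (hd w _) (hd' w u _) T hsum x₀)
      (h := fun o => f o x) (hf'.comp (measurable_id.prodMk measurable_const)) (m w x)
      (m (flip u w) x)
    refine le_of_eq_of_le ?_ h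
    congr 2
    rw [hval w u x hx, hval _ u x hx]
    cases h' : w u <;> simp [hflip, h']
  have hsumR : ∀ u, ∀ x ∈ I u, (Fintype.card (ι → Bool) : ℝ≥0∞) * ENNReal.ofReal (δ ^ 2 / 8) ≤
      ∑ w, R w x := by
    intro u x hx
    -- Flipping is a bijection, so summing over `w` counts every hypothesis twice; this halves `δ² /
    -- 4` to `δ² / 8`.
    have h1 : ∑ w, R (flip u w) x = ∑ w, R w x :=
      Equiv.sum_comp (hinv u).toPerm fun w => R w x
    have h2 : (Fintype.card (ι → Bool) : ℝ≥0∞) * ENNReal.ofReal (δ ^ 2 / 4) ≤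
        ∑ w, R w x + ∑ w, R w x := by
      nth_rewrite 2 [← h1]
      rw [← Finset.sum_add_distrib]
      calc _ = ∑ _w : ι → Bool, ENNReal.ofReal (δ ^ 2 / 4) := by simp
        _ ≤ _ := Finset.sum_le_sum fun w _ => hpair w u x hx
    have h3 : ENNReal.ofReal (δ ^ 2 / 4) = 2 * ENNReal.ofReal (δ ^ 2 / 8) := by
      rw [← ENNReal.ofReal_ofNat 2, ← ENNReal.ofReal_mul (by norm_num)]
      congr 1; ring
    rw [h3, ← two_mul, mul_left_comm] at h2
    exact (ENNReal.mul_le_mul_iff_right (by norm_num) (by norm_num)).1 h2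
  have hrisk : ∀ w, 1 / 2 * gaussianPDF 0 1 2 ^ n * ∫⁻ x in cube n 0 1, R w x ≤ S := fun w =>
    (le_risk ν (hm w) (hb w) hT hn hf).trans (le_iSup₂ (f := fun m _ => risk ν m T f) (m w) (hmM w))
  set W : ℝ≥0∞ := (Fintype.card (ι → Bool) : ℝ≥0∞) with hW
  have hfin : W * (1 / 2 * gaussianPDF 0 1 2 ^ n * (Fintype.card ι *
      (V' * ENNReal.ofReal (δ ^ 2 / 8)))) ≤ W * S := by
    calc _ = 1 / 2 * gaussianPDF 0 1 2 ^ n * ∑ _u : ι, W * ENNReal.ofReal (δ ^ 2 / 8) * V' := by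
          rw [Finset.sum_const, nsmul_eq_mul, Finset.card_univ]; ring
      _ ≤ 1 / 2 * gaussianPDF 0 1 2 ^ n * ∑ u, ∫⁻ x in I u, ∑ w, R w x := by
          refine mul_le_mul_right (Finset.sum_le_sum fun u _ => ?_) _
          calc _ ≤ W * ENNReal.ofReal (δ ^ 2 / 8) * volume (I u) := mul_le_mul_right (hIV u) _
            _ = ∫⁻ _ in I u, W * ENNReal.ofReal (δ ^ 2 / 8) := by simp
            _ ≤ _ := setLIntegral_mono' (hI u) fun x hx => hsumR u x hx
      _ ≤ 1 / 2 * gaussianPDF 0 1 2 ^ n * ∫⁻ x in cube n 0 1, ∑ w, R w x := by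
          refine mul_le_mul_right ?_ _
          rw [← tsum_fintype (L := SummationFilter.unconditional _), ← lintegral_iUnion hI hId]
          exact lintegral_mono_set (Set.iUnion_subset hIc)
      _ = ∑ w, 1 / 2 * gaussianPDF 0 1 2 ^ n * ∫⁻ x in cube n 0 1, R w x := by
          rw [lintegral_finsetSum _ fun w _ => hRm w, Finset.mul_sum]
      _ ≤ ∑ _w : ι → Bool, S := Finset.sum_le_sum fun w _ => hrisk w
      _ = W * S := by simp [hW]
  exact (ENNReal.mul_le_mul_iff_right (by simp [hW]) (by simp [hW])).1 hfin

/-! ### Bounds on Hölder norms -/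

theorem mem_cube {p : ℕ} {l u : ℝ} {x : Fin p → ℝ} : x ∈ cube p l u ↔ ∀ i, l ≤ x i ∧ x i ≤ u := by
  simp only [cube, Set.mem_Icc, Pi.le_def, forall_and]

theorem uniqueDiffOn_cube {p : ℕ} {l u : ℝ} (h : l < u) : UniqueDiffOn ℝ (cube p l u) := by
  rw [cube, ← Set.pi_univ_Icc]
  exact UniqueDiffOn.univ_pi fun _ => uniqueDiffOn_Icc h

theorem convex_cube (p : ℕ) (l u : ℝ) : Convex ℝ (cube p l u) := convex_Icc _ _

theorem norm_apply_single_le {p k : ℕ} (L : ContinuousMultilinearMap ℝ (fun _ : Fin k => Fin p → ℝ) ℝ)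
    (e : Fin k → Fin p) : ‖L fun j => Pi.single (e j) (1 : ℝ)‖ ≤ ‖L‖ := by
  refine (L.le_opNorm _).trans_eq ?_
  simp [Pi.norm_single]

theorem multiDeriv_eq {p : ℕ} {l u : ℝ} (h : l < u) {f : (Fin p → ℝ) → ℝ}
    (hf : ∀ k : ℕ, ContDiff ℝ k f) (α : Fin p → ℕ) {x : Fin p → ℝ} (hx : x ∈ cube p l u) :
    multiDeriv (cube p l u) α f x = iteratedFDeriv ℝ (∑ i, α i) f x
      (fun j => Pi.single (finSigmaFinEquiv.symm j).1 (1 : ℝ)) := by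
  rw [multiDeriv, iteratedFDerivWithin_eq_iteratedFDeriv (uniqueDiffOn_cube h)
    (hf _).contDiffAt hx]

theorem rpow_interpolation {N r s : ℝ} (hN : 1 ≤ N) (hr : 0 < r) (hs : 0 ≤ s) (hs1 : s < 1) :
    min 2 (N * r) ≤ 2 * (N ^ s * r ^ s) := by
  have hN0 : 0 < N := by linarith
  rw [← Real.mul_rpow hN0.le hr.le]
  rcases le_or_gt (N * r) 1 with h | h
  · refine (min_le_right _ _).trans ?_
    have := Real.rpow_le_rpow_of_exponent_ge (by positivity : 0 < N * r) h hs1.le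
    rw [Real.rpow_one] at this
    have h2 : 0 ≤ (N * r) ^ s := by positivity
    linarith
  · refine (min_le_left _ _).trans ?_
    have := Real.one_le_rpow h.le hs
    linarith

/-- The constant in `holderNorm_le`. -/
noncomputable def holderConst (p : ℕ) (β : ℝ) : ℝ :=
  (∑ k ∈ Finset.range ⌈β⌉₊, (multiIndices p k).card : ℕ) + 2 * ((multiIndices p ⌊β⌋₊).card : ℝ)

theorem holderConst_nonneg (p : ℕ) (β : ℝ) : 0 ≤ holderConst p β := by
  unfold holderConst; positivity

/-- Bounds `C * N ^ (k - β)` are those of a profile of width `1 / N` and height `N ^ (-β)`; the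
resulting Hölder bound is free of `N`. One derivative beyond `⌊β⌋₊` is needed to control increments
of the top one. -/
theorem holderNorm_le {p : ℕ} {β C N : ℝ} (hβ : 0 < β) (hN : 1 ≤ N) (hC : 0 ≤ C)
    {f : (Fin p → ℝ) → ℝ} (hf : ∀ k : ℕ, ContDiff ℝ k f)
    (hbd : ∀ k ≤ ⌊β⌋₊ + 1, ∀ x ∈ cube p 0 1, ‖iteratedFDeriv ℝ k f x‖ ≤ C * N ^ ((k : ℝ) - β)) :
    holderNorm p 0 1 β f ≤ ENNReal.ofReal (holderConst p β * C) := by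
  have hN0 : 0 < N := by linarith
  have hβ' := Nat.floor_le hβ.le
  have hβ1 := Nat.lt_floor_add_one β
  have h1 : ∀ k ∈ Finset.range ⌈β⌉₊, ∀ α ∈ multiIndices p k,
      (⨆ x ∈ cube p 0 1, ‖multiDeriv (cube p 0 1) α f x‖ₑ) ≤ ENNReal.ofReal C := by
    intro k hk α hα
    have hα' : ∑ i, α i = k := (Finset.mem_piAntidiag.1 hα).1
    have hk' : (k : ℝ) < β := Nat.lt_ceil.1 (Finset.mem_range.1 hk)
    refine iSup₂_le fun x hx => ?_
    rw [multiDeriv_eq zero_lt_one hf α hx, ← ofReal_norm]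
    refine ENNReal.ofReal_le_ofReal ((norm_apply_single_le _ _).trans ?_)
    rw [hα']
    refine (hbd k ((Nat.le_floor hk'.le).trans (Nat.le_succ _)) x hx).trans ?_
    exact mul_le_of_le_one_right hC (Real.rpow_le_one_of_one_le_of_nonpos hN (by linarith))
  have h2 : ∀ α ∈ multiIndices p ⌊β⌋₊, (⨆ (x ∈ cube p 0 1) (y ∈ cube p 0 1) (_ : x ≠ y),
        ‖multiDeriv (cube p 0 1) α f x - multiDeriv (cube p 0 1) α f y‖ₑ /
          edist x y ^ (β - (⌊β⌋₊ : ℝ))) ≤ ENNReal.ofReal (2 * C) := by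
    intro α hα
    have hα' : ∑ i, α i = ⌊β⌋₊ := (Finset.mem_piAntidiag.1 hα).1
    refine iSup₂_le fun x hx => iSup₂_le fun y hy => iSup_le fun hxy => ?_
    refine ENNReal.div_le_of_le_mul ?_
    rw [multiDeriv_eq zero_lt_one hf α hx, multiDeriv_eq zero_lt_one hf α hy,
      ← ofReal_norm, edist_dist,
      ENNReal.ofReal_rpow_of_nonneg dist_nonneg (by linarith), ← ENNReal.ofReal_mul (by positivity),
      ← sub_apply]
    refine ENNReal.ofReal_le_ofReal ((norm_apply_single_le _ _).trans ?_)
    rw [hα']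
    set k := ⌊β⌋₊
    have ha : ‖iteratedFDeriv ℝ k f x - iteratedFDeriv ℝ k f y‖ ≤ C * N ^ ((k : ℝ) - β) * 2 := by
      refine (norm_sub_le _ _).trans ?_
      linarith [hbd k (Nat.le_succ _) x hx, hbd k (Nat.le_succ _) y hy]
    have hb : ‖iteratedFDeriv ℝ k f x - iteratedFDeriv ℝ k f y‖ ≤
        C * N ^ ((k : ℝ) - β) * (N * dist x y) := by
      have := (convex_cube p 0 1).norm_image_sub_le_of_norm_fderiv_le (𝕜 := ℝ)
        (f := iteratedFDeriv ℝ k f) (C := C * N ^ ((k : ℝ) - β) * N) (fun z _ =>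
          ((hf (k + 1)).differentiable_iteratedFDeriv (by exact_mod_cast Nat.lt_succ_self k)) z)
        (fun z hz => ?_) hy hx
      · rwa [← dist_eq_norm x y, mul_assoc] at this
      · rw [norm_fderiv_iteratedFDeriv]
        refine (hbd (k + 1) le_rfl z hz).trans_eq ?_
        rw [mul_assoc, ← Real.rpow_add_one hN0.ne']
        congr 2
        push_cast; ring
    have hd : 0 < dist x y := dist_pos.2 hxy
    -- The triangle inequality is efficient at distances above `1 / N`, the mean value inequality
    -- below; interpolating between them gives the power `β - k`, including power `0` for integer
    -- `β`.
    have h3 := rpow_interpolation (s := β - k) hN hd (by linarith) (by linarith)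
    calc _ ≤ C * N ^ ((k : ℝ) - β) * min 2 (N * dist x y) := by
          rcases min_choice 2 (N * dist x y) with h | h <;> rw [h] <;> assumption
      _ ≤ C * N ^ ((k : ℝ) - β) * (2 * (N ^ (β - k) * dist x y ^ (β - k))) := by gcongr
      _ = 2 * C * (N ^ ((k : ℝ) - β) * N ^ (β - k)) * dist x y ^ (β - k) := by ring
      _ = _ := by
          rw [← Real.rpow_add hN0]
          simp
  rw [holderNorm, holderConst, add_mul, ENNReal.ofReal_add (by positivity) (by positivity)]
  refine add_le_add ?_ ?_
  · calc _ ≤ ∑ k ∈ Finset.range ⌈β⌉₊, ∑ α ∈ multiIndices p k, ENNReal.ofReal C :=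
        Finset.sum_le_sum fun k hk => Finset.sum_le_sum fun α hα => h1 k hk α hα
      _ = _ := by
        rw [ENNReal.ofReal_mul (by positivity), ENNReal.ofReal_natCast]
        simp [Finset.sum_mul]
  · calc _ ≤ ∑ α ∈ multiIndices p ⌊β⌋₊, ENNReal.ofReal (2 * C) :=
        Finset.sum_le_sum fun α hα => h2 α hα
      _ = _ := by
        rw [Finset.sum_const, nsmul_eq_mul, mul_comm 2 ((multiIndices p ⌊β⌋₊).card : ℝ), mul_assoc,
          ENNReal.ofReal_mul (Nat.cast_nonneg _), ENNReal.ofReal_natCast]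

/-- The coordinate with index `a`, or `0` if there is none. -/
noncomputable def coord (p a : ℕ) : (Fin p → ℝ) →L[ℝ] ℝ :=
  if h : a < p then ContinuousLinearMap.proj ⟨a, h⟩ else 0

theorem coord_of_lt {p a : ℕ} (h : a < p) (x : Fin p → ℝ) : coord p a x = x ⟨a, h⟩ := by
  simp [coord, h]

theorem norm_coord_apply_le {p a : ℕ} (x : Fin p → ℝ) : ‖coord p a x‖ ≤ ‖x‖ := by
  unfold coord
  split_ifs with h
  · exact norm_le_pi_norm x _
  · simp

theorem norm_coord_le (p a : ℕ) : ‖coord p a‖ ≤ 1 :=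
  ContinuousLinearMap.opNorm_le_bound _ zero_le_one fun x => by
    rw [one_mul]; exact norm_coord_apply_le x

theorem coord_mem {p a : ℕ} {x : Fin p → ℝ} (hx : x ∈ cube p 0 1) : coord p a x ∈ Set.Icc (0 : ℝ) 1 := by
  unfold coord
  split_ifs with h
  · exact mem_cube.1 hx _
  · simp

theorem dependsOnAtMost_coord {p r : ℕ} (hr : 1 ≤ r) (l u : ℝ) (a : ℕ) (F : ℝ → ℝ) :
    DependsOnAtMost p r l u fun x => F (coord p a x) := by
  by_cases h : a < p
  · refine ⟨{⟨a, h⟩}, by simpa using hr, fun x _ y _ hxy => ?_⟩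
    simp only [coord_of_lt h]
    rw [hxy _ (Finset.mem_singleton_self _)]
  · exact ⟨∅, by simp, fun x _ y _ _ => by simp [coord, h]⟩

theorem coord_mem_holderClass {p r : ℕ} (hr : 1 ≤ r) {β A : ℝ} (hβ : 0 < β)
    (hA : holderConst p β ≤ A) (a : ℕ) :
    (fun x => coord p a x) ∈ holderClass p r 0 1 β A := by
  have hc : ∀ k : ℕ, ContDiff ℝ k (coord p a) := fun k => (coord p a).contDiff
  refine ⟨dependsOnAtMost_coord hr 0 1 a id, (hc _).contDiffOn, ?_⟩
  refine (holderNorm_le (C := 1) (N := 1) hβ le_rfl zero_le_one hc fun k _ x hx => ?_).trans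
    (ENNReal.ofReal_le_ofReal (by rwa [mul_one]))
  rw [Real.one_rpow, mul_one]
  match k with
  | 0 =>
    rw [norm_iteratedFDeriv_zero, Real.norm_eq_abs, abs_of_nonneg (coord_mem hx).1]
    exact (coord_mem hx).2
  | 1 =>
    rw [← norm_iteratedFDeriv_fderiv, norm_iteratedFDeriv_zero, ContinuousLinearMap.fderiv]
    exact norm_coord_le p a
  | k + 2 =>
    rw [← norm_iteratedFDeriv_fderiv]
    have : fderiv ℝ (coord p a) = fun _ => coord p a := by
      funext y; exact ContinuousLinearMap.fderiv _
    rw [this, iteratedFDeriv_const_of_ne (Nat.succ_ne_zero k)]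
    simp

theorem abs_rpow_sub_rpow_le {x y s : ℝ} (hx : 0 ≤ x) (hy : 0 ≤ y) (hs : 0 ≤ s) (hs1 : s ≤ 1) :
    |x ^ s - y ^ s| ≤ |x - y| ^ s := by
  wlog h : y ≤ x generalizing x y
  · rw [abs_sub_comm, abs_sub_comm x]
    exact this hy hx (le_of_not_ge h)
  rw [abs_of_nonneg (sub_nonneg.2 h),
    abs_of_nonneg (sub_nonneg.2 (Real.rpow_le_rpow hy h hs))]
  have := Real.rpow_add_le_add_rpow hy (sub_nonneg.2 h) hs hs1
  rw [add_sub_cancel] at this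
  linarith

/-- For `β ≥ 1` the function is linear. For `β < 1` only its supremum and its `β`-Hölder quotient
enter the norm, each at most `1`, so the singularity at `0` does no harm. -/
theorem coord_rpow_mem_holderClass {p r : ℕ} (hr : 1 ≤ r) {β A : ℝ} (hβ : 0 < β)
    (hA : holderConst p β + 2 ≤ A) (a : ℕ) :
    (fun x => coord p a x ^ min β 1) ∈ holderClass p r 0 1 β A := by
  rcases le_or_gt 1 β with h1 | h1
  · simp only [min_eq_right h1, Real.rpow_one]
    exact coord_mem_holderClass hr hβ (by linarith) a
  rw [min_eq_left h1.le]
  have hfl : ⌊β⌋₊ = 0 := Nat.floor_eq_zero.2 h1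
  have hce : ⌈β⌉₊ = 1 := by
    rw [Nat.ceil_eq_iff one_ne_zero]; simp [hβ, h1.le]
  -- The order `∑ i, 0` is not syntactically `0`, so the identity is first proved for a general
  -- order equal to zero.
  have hz : ∀ x, multiDeriv (cube p 0 1) 0 (fun x => coord p a x ^ β) x = coord p a x ^ β := by
    intro x
    have : ∀ k, k = 0 → ∀ e : Fin k → Fin p → ℝ, iteratedFDerivWithin ℝ k
        (fun x => coord p a x ^ β) (cube p 0 1) x e = coord p a x ^ β := by
      rintro k rfl e
      exact iteratedFDerivWithin_zero_apply e
    exact this _ (by simp) _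
  have hmi : multiIndices p 0 = {0} := by simp [multiIndices]
  refine ⟨dependsOnAtMost_coord hr 0 1 a fun z => z ^ β, ?_, ?_⟩
  · rw [hfl]
    exact contDiffOn_zero.2 ((coord p a).continuous.rpow_const fun _ => Or.inr hβ.le).continuousOn
  · have hA2 : (2 : ℝ) ≤ A := by linarith [holderConst_nonneg p β]
    refine le_trans ?_ (ENNReal.ofReal_le_ofReal hA2)
    rw [holderNorm, hfl, hce, Finset.sum_range_one, hmi, Finset.sum_singleton,
      Finset.sum_singleton, ENNReal.ofReal_ofNat, ← one_add_one_eq_two]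
    refine add_le_add ?_ ?_
    · refine iSup₂_le fun x hx => ?_
      have hx' := coord_mem (a := a) hx
      rw [hz, ← ofReal_norm, ← ENNReal.ofReal_one, Real.norm_eq_abs,
        abs_of_nonneg (Real.rpow_nonneg hx'.1 _)]
      exact ENNReal.ofReal_le_ofReal (Real.rpow_le_one hx'.1 hx'.2 hβ.le)
    · refine iSup₂_le fun x hx => iSup₂_le fun y hy => iSup_le fun hxy => ?_
      refine ENNReal.div_le_of_le_mul ?_
      rw [hz, hz, one_mul, ← ofReal_norm, edist_dist,
        ENNReal.ofReal_rpow_of_nonneg dist_nonneg (by simpa using hβ.le)]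
      refine ENNReal.ofReal_le_ofReal ?_
      rw [Nat.cast_zero, sub_zero, Real.norm_eq_abs]
      refine (abs_rpow_sub_rpow_le (coord_mem hx).1 (coord_mem hy).1 hβ.le h1.le).trans ?_
      refine Real.rpow_le_rpow (abs_nonneg _) ?_ hβ.le
      rw [← map_sub, dist_eq_norm]
      exact norm_coord_apply_le _

/-! ### Sums of bumps on a grid -/

/-- A smooth bump on the unit cube. -/
noncomputable def unitBump (s : ℕ) : ContDiffBump (fun _ : Fin s => (1 / 2 : ℝ)) :=
  -- In the sup-distance the plateau is `[1/4, 3/4]^s` and the closed support lies in `[1/8,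
  -- 7/8]^s`, strictly inside the cell.
  ⟨1 / 4, 3 / 8, by norm_num, by norm_num⟩

theorem mem_of_mem_tsupport {s : ℕ} {z : Fin s → ℝ} (hz : z ∈ tsupport (unitBump s)) (a : Fin s) :
    0 < z a ∧ z a < 1 := by
  rw [ContDiffBump.tsupport_eq, Metric.mem_closedBall, dist_pi_le_iff (unitBump s).rOut_pos.le] at hz
  have h := hz a
  have h2 : (unitBump s).rOut = 3 / 8 := rfl
  rw [Real.dist_eq, h2, abs_le] at h
  constructor <;> linarith

theorem unitBump_eq_one {s : ℕ} {z : Fin s → ℝ} (hz : ∀ a, 1 / 4 ≤ z a ∧ z a ≤ 3 / 4) :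
    unitBump s z = 1 := by
  refine (unitBump s).one_of_mem_closedBall ?_
  rw [Metric.mem_closedBall, dist_pi_le_iff (unitBump s).rIn_pos.le]
  intro a
  have h2 : (unitBump s).rIn = 1 / 4 := rfl
  rw [Real.dist_eq, h2, abs_le]
  constructor <;> linarith [hz a]

/-- The corner of the grid cell `u`. -/
def corner {s N : ℕ} (u : Fin s → Fin N) : Fin s → ℝ := fun a => (u a : ℝ)

theorem cell_unique {s N : ℕ} {u u' : Fin s → Fin N} {z : Fin s → ℝ}
    (h : ∀ a, 0 < z a - corner u a ∧ z a - corner u a < 1)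
    (h' : ∀ a, 0 < z a - corner u' a ∧ z a - corner u' a < 1) : u = u' := by
  funext a
  have h1 := h a
  have h2 := h' a
  simp only [corner] at h1 h2
  have h3 : ((u a : ℕ) : ℝ) < (u' a : ℕ) + 1 := by linarith
  have h4 : ((u' a : ℕ) : ℝ) < (u a : ℕ) + 1 := by linarith
  have h5 : (u a : ℕ) < u' a + 1 := by exact_mod_cast h3
  have h6 : (u' a : ℕ) < u a + 1 := by exact_mod_cast h4
  exact Fin.ext (by omega)

/-- The sum of the bumps on the cells `u` with `w u`. -/
noncomputable def bumpSum {s N : ℕ} (w : (Fin s → Fin N) → Bool) (z : Fin s → ℝ) : ℝ :=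
  ∑ u, if w u then unitBump s (z - corner u) else 0

/-- Closed supports in different cells are disjoint, so only one term can be nonzero. -/
theorem bumpSum_eq {s N : ℕ} (w : (Fin s → Fin N) → Bool) (u : Fin s → Fin N) {z : Fin s → ℝ}
    (hz : z - corner u ∈ tsupport (unitBump s)) :
    bumpSum w z = if w u then unitBump s (z - corner u) else 0 := by
  refine Finset.sum_eq_single u (fun u' _ hu => ?_) (by simp)
  rw [ite_eq_right_iff]
  intro _
  by_contra hne
  exact hu (cell_unique (z := z) (mem_of_mem_tsupport (subset_tsupport _ hne))
    (mem_of_mem_tsupport hz))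

theorem bumpSum_mem {s N : ℕ} (w : (Fin s → Fin N) → Bool) (z : Fin s → ℝ) :
    bumpSum w z ∈ Set.Icc (0 : ℝ) 1 := by
  by_cases h : ∃ u : Fin s → Fin N, z - corner u ∈ tsupport (unitBump s)
  · obtain ⟨u, hu⟩ := h
    rw [bumpSum_eq w u hu]
    split_ifs
    · exact ⟨(unitBump s).nonneg, (unitBump s).le_one⟩
    · simp
  · rw [bumpSum, Finset.sum_eq_zero]
    · simp
    · intro u _
      rw [ite_eq_right_iff]
      intro _
      by_contra hne
      exact h ⟨u, subset_tsupport _ hne⟩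

theorem bumpSum_of_mem {s N : ℕ} (w : (Fin s → Fin N) → Bool) (u : Fin s → Fin N) {z : Fin s → ℝ}
    (hz : ∀ a, 1 / 4 ≤ z a - corner u a ∧ z a - corner u a ≤ 3 / 4) :
    bumpSum w z = if w u then 1 else 0 := by
  have h1 : unitBump s (z - corner u) = 1 := unitBump_eq_one hz
  rw [bumpSum_eq w u (subset_tsupport _ (by simp [h1])), h1]

theorem bumpSum_update {s N : ℕ} (w : (Fin s → Fin N) → Bool) (u : Fin s → Fin N) (b : Bool)
    {z : Fin s → ℝ} (hz : ¬ ∀ a, 0 ≤ z a - corner u a ∧ z a - corner u a ≤ 1) :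
    bumpSum w z = bumpSum (Function.update w u b) z := by
  refine Finset.sum_congr rfl fun u' _ => ?_
  by_cases h : u' = u
  · subst h
    have h0 : unitBump s (z - corner u') = 0 := by
      by_contra hne
      refine hz fun a => ?_
      have := mem_of_mem_tsupport (subset_tsupport _ hne) a
      exact ⟨this.1.le, this.2.le⟩
    simp [h0]
  · rw [Function.update_of_ne h]

theorem contDiff_bumpTerm {s N : ℕ} (w : (Fin s → Fin N) → Bool) (u : Fin s → Fin N) (k : ℕ) :
    ContDiff ℝ k fun z : Fin s → ℝ => if w u then unitBump s (z - corner u) else 0 := by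
  split_ifs
  · exact (unitBump s).contDiff.comp (contDiff_id.sub contDiff_const)
  · exact contDiff_const

theorem contDiff_bumpSum {s N : ℕ} (w : (Fin s → Fin N) → Bool) (k : ℕ) :
    ContDiff ℝ k (bumpSum w) :=
  ContDiff.sum fun u _ => contDiff_bumpTerm w u k

/-- At every point at most one term has a nonzero derivative, so the bound does not grow with the
number of cells. -/
theorem norm_iteratedFDeriv_bumpSum_le {s N : ℕ} (w : (Fin s → Fin N) → Bool) {k : ℕ} {C : ℝ}
    (hC : ∀ z, ‖iteratedFDeriv ℝ k (unitBump s) z‖ ≤ C) (z : Fin s → ℝ) :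
    ‖iteratedFDeriv ℝ k (bumpSum w) z‖ ≤ C := by
  have hC0 : 0 ≤ C := (norm_nonneg _).trans (hC 0)
  have hterm : ∀ u, iteratedFDeriv ℝ k
      (fun z : Fin s → ℝ => if w u then unitBump s (z - corner u) else 0) z =
      if w u then iteratedFDeriv ℝ k (unitBump s) (z - corner u) else 0 := by
    intro u
    split_ifs
    · exact iteratedFDeriv_comp_sub k _ z
    · rw [iteratedFDeriv_fun_zero]; rfl
  have hsum : iteratedFDeriv ℝ k (bumpSum w) z =
      ∑ u, if w u then iteratedFDeriv ℝ k (unitBump s) (z - corner u) else 0 := by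
    have := iteratedFDeriv_sum (𝕜 := ℝ) (i := k) (u := Finset.univ)
      (f := fun (u : Fin s → Fin N) (z : Fin s → ℝ) =>
        if w u then unitBump s (z - corner u) else 0) fun u _ => contDiff_bumpTerm w u k
    change iteratedFDeriv ℝ k (fun z => ∑ u, _) z = _
    rw [this, Finset.sum_apply]
    exact Finset.sum_congr rfl fun u _ => hterm u
  rw [hsum]
  have hsupp : ∀ u : Fin s → Fin N,
      (if w u then iteratedFDeriv ℝ k (unitBump s) (z - corner u) else 0) ≠ 0 →
      z - corner u ∈ tsupport (unitBump s) := fun u hu => by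
    refine support_iteratedFDeriv_subset (𝕜 := ℝ) k ?_
    intro h0
    simp [h0] at hu
  by_cases h : ∃ u : Fin s → Fin N, z - corner u ∈ tsupport (unitBump s)
  · obtain ⟨u, hu⟩ := h
    rw [Finset.sum_eq_single u (fun u' _ hu' => by
      by_contra hne
      exact hu' (cell_unique (z := z) (mem_of_mem_tsupport (hsupp u' hne))
        (mem_of_mem_tsupport hu))) (by simp)]
    split_ifs
    · exact hC _
    · simpa using hC0
  · rw [Finset.sum_eq_zero fun u _ => by
      by_contra hne
      exact h ⟨u, hsupp u hne⟩]
    simpa using hC0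

theorem exists_unitBump_bound (s K : ℕ) :
    ∃ C : ℝ, 0 ≤ C ∧ ∀ k ≤ K, ∀ z, ‖iteratedFDeriv ℝ k (unitBump s) z‖ ≤ C := by
  have h : ∀ k, ∃ C : ℝ, ∀ z, ‖iteratedFDeriv ℝ k (unitBump s) z‖ ≤ C := fun k =>
    ((unitBump s).hasCompactSupport.iteratedFDeriv k).exists_bound_of_continuous
      (((unitBump s).contDiff (n := k)).continuous_iteratedFDeriv le_rfl)
  choose C hC using h
  have hC0 : ∀ k, 0 ≤ C k := fun k => (norm_nonneg _).trans (hC k 0)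
  refine ⟨∑ k ∈ Finset.range (K + 1), C k, Finset.sum_nonneg fun k _ => hC0 k, fun k hk z => ?_⟩
  exact (hC k z).trans (Finset.single_le_sum (f := C) (fun k _ => hC0 k)
    (Finset.mem_range.2 (by omega)))

/-- The first `s` coordinates, multiplied by `N`. -/
noncomputable def scaledCoords (p s N : ℕ) : (Fin p → ℝ) →L[ℝ] (Fin s → ℝ) :=
  ContinuousLinearMap.pi fun a => (N : ℝ) • coord p a

theorem scaledCoords_apply (p s N : ℕ) (x : Fin p → ℝ) (a : Fin s) :
    scaledCoords p s N x a = N * coord p a x := rfl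

theorem norm_scaledCoords_le (p s N : ℕ) : ‖scaledCoords p s N‖ ≤ N := by
  refine ContinuousLinearMap.opNorm_le_bound _ (Nat.cast_nonneg N) fun x => ?_
  refine (pi_norm_le_iff_of_nonneg (by positivity)).2 fun a => ?_
  rw [scaledCoords_apply, norm_mul, Real.norm_natCast]
  exact mul_le_mul_of_nonneg_left (norm_coord_apply_le x) (Nat.cast_nonneg N)

/-- The bumps on the grid of mesh `1 / N`, of height `N ^ (-β)`. -/
noncomputable def gridFun (p : ℕ) {s N : ℕ} (β : ℝ) (w : (Fin s → Fin N) → Bool) (x : Fin p → ℝ) :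
    ℝ :=
  (N : ℝ) ^ (-β) * bumpSum w (scaledCoords p s N x)

theorem gridFun_mem (p : ℕ) {s N : ℕ} (hN : 1 ≤ N) {β : ℝ} (hβ : 0 < β)
    (w : (Fin s → Fin N) → Bool) (x : Fin p → ℝ) :
    0 ≤ gridFun p β w x ∧ gridFun p β w x ≤ (N : ℝ) ^ (-β) ∧ gridFun p β w x ≤ 1 := by
  have hb := bumpSum_mem w (scaledCoords p s N x)
  have h1 : (N : ℝ) ^ (-β) ≤ 1 :=
    Real.rpow_le_one_of_one_le_of_nonpos (by exact_mod_cast hN) (by linarith)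
  have h0 : (0 : ℝ) ≤ (N : ℝ) ^ (-β) := by positivity
  have h2 : gridFun p β w x ≤ (N : ℝ) ^ (-β) := mul_le_of_le_one_right h0 hb.2
  exact ⟨mul_nonneg h0 hb.1, h2, h2.trans h1⟩

theorem contDiff_gridFun (p : ℕ) {s N : ℕ} (β : ℝ) (w : (Fin s → Fin N) → Bool) (k : ℕ) :
    ContDiff ℝ k (gridFun p β w) :=
  contDiff_const.mul ((contDiff_bumpSum w k).comp (scaledCoords p s N).contDiff)

theorem dependsOnAtMost_gridFun (p : ℕ) {s N : ℕ} (l u β : ℝ) (w : (Fin s → Fin N) → Bool) :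
    DependsOnAtMost p s l u (gridFun p β w) := by
  classical
  refine ⟨Finset.univ.filter fun i : Fin p => (i : ℕ) < s, ?_, fun x _ y _ hxy => ?_⟩
  · have : ((Finset.univ.filter fun i : Fin p => (i : ℕ) < s).image fun i : Fin p => (i : ℕ)) ⊆
        Finset.range s := fun i hi => by
      obtain ⟨j, hj, rfl⟩ := Finset.mem_image.1 hi
      exact Finset.mem_range.2 (Finset.mem_filter.1 hj).2
    have h2 := Finset.card_le_card this
    rwa [Finset.card_image_of_injective _ Fin.val_injective, Finset.card_range] at h2
  · have : scaledCoords p s N x = scaledCoords p s N y := by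
      funext a
      rw [scaledCoords_apply, scaledCoords_apply]
      by_cases h : (a : ℕ) < p
      · rw [coord_of_lt h, coord_of_lt h, hxy ⟨a, h⟩ (by simp)]
      · simp [coord, h]
    rw [gridFun, gridFun, this]

/-- By the chain rule, `k` derivatives cost a factor `N ^ k` against the height `N ^ (-β)`, exactly
the scaling of `holderNorm_le`. -/
theorem exists_gridFun_mem_holderClass (p s : ℕ) {β : ℝ} (hβ : 0 < β) :
    ∃ A₀ : ℝ, ∀ A, A₀ ≤ A → ∀ (N : ℕ), 1 ≤ N → ∀ w : (Fin s → Fin N) → Bool,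
      gridFun p β w ∈ holderClass p s 0 1 β A := by
  obtain ⟨C, hC0, hC⟩ := exists_unitBump_bound s (⌊β⌋₊ + 1)
  refine ⟨holderConst p β * C, fun A hA N hN w =>
    ⟨dependsOnAtMost_gridFun p 0 1 β w, (contDiff_gridFun p β w _).contDiffOn, ?_⟩⟩
  have hN' : (1 : ℝ) ≤ N := by exact_mod_cast hN
  refine (holderNorm_le (N := N) hβ hN' hC0 (contDiff_gridFun p β w)
    fun k hk x _ => ?_).trans (ENNReal.ofReal_le_ofReal hA)
  have e : gridFun p β w = (N : ℝ) ^ (-β) • (bumpSum w ∘ scaledCoords p s N) := by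
    funext x; rfl
  have hcd : ContDiff ℝ k (bumpSum w ∘ scaledCoords p s N) :=
    (contDiff_bumpSum w k).comp (scaledCoords p s N).contDiff
  have hnn : (0 : ℝ) ≤ (N : ℝ) ^ (-β) := by positivity
  rw [e, iteratedFDeriv_const_smul_apply hcd.contDiffAt, norm_smul, Real.norm_of_nonneg hnn,
    (scaledCoords p s N).iteratedFDeriv_comp_right (contDiff_bumpSum w k) x le_rfl]
  calc _ ≤ (N : ℝ) ^ (-β) * (C * (N : ℝ) ^ k) := by
        refine mul_le_mul_of_nonneg_left ?_ hnn
        refine (ContinuousMultilinearMap.norm_compContinuousLinearMap_le _ _).trans ?_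
        refine mul_le_mul (norm_iteratedFDeriv_bumpSum_le w (hC k hk) _) ?_ (by positivity) hC0
        rw [Finset.prod_const, Finset.card_univ, Fintype.card_fin]
        exact pow_le_pow_left₀ (norm_nonneg _) (norm_scaledCoords_le p s N) k
    _ = C * ((N : ℝ) ^ (k : ℝ) * (N : ℝ) ^ (-β)) := by rw [Real.rpow_natCast]; ring
    _ = _ := by rw [← Real.rpow_add (by linarith), sub_eq_add_neg]

/-! ### The hypotheses -/

theorem gridFun_congr {p p' s N : ℕ} (β : ℝ) (w : (Fin s → Fin N) → Bool) {x : Fin p → ℝ}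
    {y : Fin p' → ℝ} (h : ∀ a < s, coord p a x = coord p' a y) :
    gridFun p β w x = gridFun p' β w y := by
  have : scaledCoords p s N x = scaledCoords p' s N y := by
    funext a
    rw [scaledCoords_apply, scaledCoords_apply, h a a.2]
  rw [gridFun, gridFun, this]

/-- The layer `i'` of the composition: it copies coordinates for `i' < i`, is the grid function for
`i' = i`, and a power of the first coordinate for `i' > i`. -/
noncomputable def layer {q : ℕ} (i i' : Fin (q + 1)) {s N : ℕ} (b γ : ℝ)
    (w : (Fin s → Fin N) → Bool) {p p' : ℕ} (x : Fin p → ℝ) : Fin p' → ℝ := fun j =>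
  if i' < i then coord p j x else if i' = i then gridFun p b w x else coord p 0 x ^ γ

/-- The exponent that the layers `l < k` with `l > i` apply to the grid function. -/
noncomputable def tailExponent {q : ℕ} (β : Fin (q + 1) → ℝ) (i : Fin (q + 1)) (k : Fin (q + 2)) :
    ℝ :=
  ∏ l ∈ (Finset.Ioi i).filter (fun l => l.castSucc < k), min (β l) 1

theorem tailExponent_succ_self {q : ℕ} (β : Fin (q + 1) → ℝ) (i : Fin (q + 1)) :
    tailExponent β i i.succ = 1 := by
  rw [tailExponent, Finset.filter_eq_empty_iff.2, Finset.prod_empty]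
  intro l hl h
  rw [Finset.mem_Ioi, Fin.lt_def] at hl
  rw [Fin.lt_def] at h
  simp at h
  omega

theorem tailExponent_succ {q : ℕ} (β : Fin (q + 1) → ℝ) {i i' : Fin (q + 1)} (h : i < i') :
    tailExponent β i i'.succ = tailExponent β i i'.castSucc * min (β i') 1 := by
  have : (Finset.Ioi i).filter (fun l => l.castSucc < i'.succ) =
      insert i' ((Finset.Ioi i).filter fun l => l.castSucc < i'.castSucc) := by
    ext l
    simp only [Finset.mem_filter, Finset.mem_Ioi, Finset.mem_insert, Fin.lt_def, Fin.ext_iff,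
      Fin.val_castSucc, Fin.val_succ] at h ⊢
    omega
  rw [tailExponent, this, Finset.prod_insert (by simp), mul_comm]
  rfl

theorem tailExponent_last {q : ℕ} (β : Fin (q + 1) → ℝ) (i : Fin (q + 1)) :
    tailExponent β i (Fin.last (q + 1)) = ∏ l ∈ Finset.Ioi i, min (β l) 1 := by
  rw [tailExponent, Finset.filter_true_of_mem fun l _ => Fin.castSucc_lt_last l]

section Composite

variable {q : ℕ} {d : Fin (q + 2) → ℕ} {s N : ℕ}

theorem composite_succ (g : ∀ i : Fin (q + 1), (Fin (d i.castSucc) → ℝ) → (Fin (d i.succ) → ℝ))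
    (k : Fin (q + 1)) (x : Fin (d 0) → ℝ) :
    composite g k.succ x = g k (composite g k.castSucc x) := rfl

/-- Copying is lossless for the first `s` coordinates because no dimension up to the input of layer
`i` is smaller than `s`; this is where the condition on the `t j` matters. -/
theorem coord_composite_layer (i : Fin (q + 1)) (hs : ∀ k : Fin (q + 1), k ≤ i → s ≤ d k.castSucc)
    (b : ℝ) (β : Fin (q + 1) → ℝ) (w : (Fin s → Fin N) → Bool) (x : Fin (d 0) → ℝ)
    (k : Fin (q + 2)) (hk : k ≤ i.castSucc) {a : ℕ} (ha : a < s) :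
    coord (d k) a (composite (d := d) (fun i' => layer i i' b (min (β i') 1) w) k x) =
      coord (d 0) a x := by
  induction k using Fin.induction with
  | zero => rfl
  | succ k ih =>
    have hki : k < i := by
      rw [Fin.le_def] at hk; rw [Fin.lt_def]; simp at hk; omega
    obtain ⟨k', hk', hk'i⟩ : ∃ k' : Fin (q + 1), k'.castSucc = k.succ ∧ k' ≤ i := by
      refine ⟨⟨k + 1, by have := i.2; rw [Fin.lt_def] at hki; omega⟩, Fin.ext (by simp), ?_⟩
      rw [Fin.le_def]; rw [Fin.lt_def] at hki; simpa using hki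
    have hlt : a < d k.succ := hk' ▸ ha.trans_le (hs k' hk'i)
    rw [composite_succ, coord_of_lt hlt, ← ih (by
      rw [Fin.le_def]; rw [Fin.lt_def] at hki; simpa using hki.le)]
    simp only [layer, hki, if_true]

/-- From layer `i` on, all output coordinates agree, so reading the first one suffices and the
exponents multiply. -/
theorem composite_layer (i : Fin (q + 1)) (hpos : ∀ k : Fin (q + 1), 1 ≤ d k.castSucc)
    (hs : ∀ k : Fin (q + 1), k ≤ i → s ≤ d k.castSucc) (hN : 1 ≤ N)
    {b : ℝ} (hb : 0 < b) (β : Fin (q + 1) → ℝ) (w : (Fin s → Fin N) → Bool) (x : Fin (d 0) → ℝ)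
    (k : Fin (q + 2)) (hk : i.castSucc < k) (j : Fin (d k)) :
    composite (d := d) (fun i' => layer i i' b (min (β i') 1) w) k x j =
      gridFun (d 0) b w x ^ tailExponent β i k := by
  induction k using Fin.induction with
  | zero => exact absurd hk (Fin.not_lt_zero _)
  | succ k ih =>
    rw [composite_succ]
    rcases eq_or_ne k i with rfl | hne
    · simp only [layer, lt_irrefl, if_false, if_true]
      rw [tailExponent_succ_self, Real.rpow_one]
      exact gridFun_congr b w fun a ha => coord_composite_layer k hs b β w x _ le_rfl ha
    · have hik : i < k := by
        rw [Fin.lt_def] at hk ⊢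
        have := Fin.val_ne_of_ne hne
        simp at hk; omega
      simp only [layer, hik.not_gt, hne, if_false]
      rw [coord_of_lt (hpos k), ih (by rw [Fin.lt_def] at hik ⊢; simpa using hik),
        tailExponent_succ β hik, Real.rpow_mul (gridFun_mem _ hN hb w x).1]

end Composite

theorem layer_mapsTo {q : ℕ} (i i' : Fin (q + 1)) {s N : ℕ} (hN : 1 ≤ N) {b γ : ℝ} (hb : 0 < b)
    (hγ : 0 ≤ γ) (w : (Fin s → Fin N) → Bool) (p p' : ℕ) :
    Set.MapsTo (layer i i' b γ w : (Fin p → ℝ) → (Fin p' → ℝ)) (cube p 0 1) (cube p' 0 1) := by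
  intro x hx
  rw [mem_cube]
  intro j
  unfold layer
  split_ifs
  · exact coord_mem hx
  · exact ⟨(gridFun_mem p hN hb w x).1, (gridFun_mem p hN hb w x).2.2⟩
  · have := coord_mem (a := 0) hx
    exact ⟨Real.rpow_nonneg this.1 _, Real.rpow_le_one this.1 this.2 hγ⟩

/-- The mean functions of the lower bound. -/
noncomputable def hypothesis (n : ℕ) {s N : ℕ} (b B : ℝ) (w : (Fin s → Fin N) → Bool) :
    (Fin n → ℝ) → ℝ :=
  (cube n 0 1).indicator fun x => gridFun n b w x ^ B

theorem measurable_hypothesis (n : ℕ) {s N : ℕ} (b B : ℝ) (w : (Fin s → Fin N) → Bool) :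
    Measurable (hypothesis n b B w) :=
  ((contDiff_gridFun n b w 0).continuous.measurable.pow_const B).indicator
    (measurableSet_cube n 0 1)

theorem hypothesis_mem (n : ℕ) {s N : ℕ} (hN : 1 ≤ N) {b B : ℝ} (hb : 0 < b) (hB : 0 ≤ B)
    (w : (Fin s → Fin N) → Bool) (x : Fin n → ℝ) :
    0 ≤ hypothesis n b B w x ∧ hypothesis n b B w x ≤ (N : ℝ) ^ (-(b * B)) := by
  unfold hypothesis
  by_cases hx : x ∈ cube n 0 1
  · rw [Set.indicator_of_mem hx]
    have h := gridFun_mem n hN hb w x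
    refine ⟨Real.rpow_nonneg h.1 _, (Real.rpow_le_rpow h.1 h.2.1 hB).trans_eq ?_⟩
    rw [← Real.rpow_mul (Nat.cast_nonneg N), neg_mul]
  · rw [Set.indicator_of_notMem hx]
    exact ⟨le_rfl, by positivity⟩

theorem exists_hypothesis_mem_meanClass (q : ℕ) (d : Fin (q + 2) → ℕ) (t : Fin (q + 1) → ℕ)
    (β : Fin (q + 1) → ℝ) (ht_pos : ∀ i, 1 ≤ t i) (ht_le : ∀ i : Fin (q + 1), t i ≤ d i.castSucc)
    (hβ : ∀ i, 0 < β i) (ht_min : ∀ i j : Fin (q + 1), i < j → t j ≤ d i.castSucc)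
    (i : Fin (q + 1)) :
    ∃ A₀ : ℝ, 0 < A₀ ∧ ∀ A, A₀ ≤ A → ∀ c : Fin (d 0 + 1) → ℝ, (∀ j, 0 < c j) → A ≤ c 0 →
      ∀ N : ℕ, 1 ≤ N → ∀ w : (Fin (t i) → Fin N) → Bool,
        hypothesis (d 0) (β i) (∏ l ∈ Finset.Ioi i, min (β l) 1) w ∈ meanClass q d c t β A := by
  obtain ⟨A₁, hA₁⟩ := exists_gridFun_mem_holderClass (d i.castSucc) (t i) (hβ i)
  set S : ℝ := ∑ i' : Fin (q + 1), holderConst (d i'.castSucc) (β i') with hS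
  have hS' : ∀ i' : Fin (q + 1), holderConst (d i'.castSucc) (β i') ≤ S := fun i' =>
    Finset.single_le_sum (f := fun i' : Fin (q + 1) => holderConst (d i'.castSucc) (β i'))
      (fun _ _ => holderConst_nonneg _ _) (Finset.mem_univ i')
  have hS0 : 0 ≤ S := (holderConst_nonneg _ _).trans (hS' i)
  have hγ : ∀ l, 0 ≤ min (β l) 1 := fun l => le_min (hβ l).le zero_le_one
  -- `A₁` serves the grid layer and `S + 2` the copies and powers. Also `A ≥ 1`, so the range
  -- endpoints `0, 1` are admissible and `c 0 ≥ A` dominates the mean function.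
  refine ⟨max A₁ (S + 2), lt_max_of_lt_right (by linarith), fun A hA c hc hAc N hN w => ?_⟩
  have hA1 : A₁ ≤ A := (le_max_left _ _).trans hA
  have hA2 : S + 2 ≤ A := (le_max_right _ _).trans hA
  refine ⟨⟨measurable_hypothesis _ _ _ w, fun x => ?_⟩, fun _ => 0, fun _ => 1,
    fun i' => layer i i' (β i) (min (β i') 1) w, rfl, rfl, fun _ => zero_lt_one, fun _ => ?_,
    fun i' => layer_mapsTo i i' hN (hβ i) (hγ i') w _ _, fun i' j => ?_, fun x hx j => ?_⟩
  · have h := hypothesis_mem (d 0) hN (hβ i) (B := ∏ l ∈ Finset.Ioi i, min (β l) 1)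
      (Finset.prod_nonneg fun l _ => hγ l) w x
    rw [abs_of_nonneg h.1]
    have h1 : (N : ℝ) ^ (-(β i * ∏ l ∈ Finset.Ioi i, min (β l) 1)) ≤ 1 :=
      Real.rpow_le_one_of_one_le_of_nonpos (by exact_mod_cast hN)
        (neg_nonpos.2 (mul_nonneg (hβ i).le (Finset.prod_nonneg fun l _ => hγ l)))
    have h2 : 0 ≤ ∑ i : Fin (d 0), c i.succ * |x i| :=
      Finset.sum_nonneg fun j _ => mul_nonneg (hc _).le (abs_nonneg _)
    linarith [h.2]
  · simp only [abs_zero, abs_one]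
    constructor <;> linarith
  · have h1 := hS' i'
    rcases lt_trichotomy i' i with h | h | h
    · simp only [layer, h, if_true]
      exact coord_mem_holderClass (ht_pos i') (hβ i') (by linarith) _
    · subst h
      simp only [layer, lt_irrefl, if_false, if_true]
      exact hA₁ A hA1 N hN w
    · simp only [layer, h.not_gt, h.ne', if_false]
      exact coord_rpow_mem_holderClass (ht_pos i') (hβ i') (by linarith) 0
  · rw [composite_layer i (fun k => (ht_pos k).trans (ht_le k)) (fun k hk => ?_) hN (hβ i) β w x _
      (Fin.castSucc_lt_last i) j, tailExponent_last, hypothesis, Set.indicator_of_mem hx]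
    rcases hk.lt_or_eq with h | rfl
    exacts [ht_min k i h, ht_le k]

/-! ### Grid boxes -/

/-- The set of the points of the unit cube whose first `s` coordinates are in the cell `u`, at
relative positions in `[e, f]`. -/
def gridBox (n : ℕ) {s N : ℕ} (e f : ℝ) (u : Fin s → Fin N) : Set (Fin n → ℝ) :=
  Set.Icc (fun j => if h : (j : ℕ) < s then ((u ⟨j, h⟩ : ℝ) + e) / N else 0)
    (fun j => if h : (j : ℕ) < s then ((u ⟨j, h⟩ : ℝ) + f) / N else 1)

theorem mem_gridBox {n s N : ℕ} (hs : s ≤ n) (hN : 1 ≤ N) {e f : ℝ} (he : 0 ≤ e) (hf : f ≤ 1)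
    {u : Fin s → Fin N} {x : Fin n → ℝ} :
    x ∈ gridBox n e f u ↔ x ∈ cube n 0 1 ∧ ∀ a, e ≤ scaledCoords n s N x a - corner u a ∧
      scaledCoords n s N x a - corner u a ≤ f := by
  have hN0 : (0 : ℝ) < N := by exact_mod_cast hN
  rw [mem_cube]
  simp only [gridBox, Set.mem_Icc, Pi.le_def, ← forall_and, scaledCoords_apply, corner]
  constructor
  · intro h
    refine ⟨fun j => ?_, fun a => ?_⟩
    · have hj := h j
      split_ifs at hj with hjs
      · rw [div_le_iff₀ hN0, le_div_iff₀ hN0] at hj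
        have hu : ((u ⟨j, hjs⟩ : ℕ) : ℝ) + 1 ≤ N := by exact_mod_cast (u ⟨j, hjs⟩).2
        have hu0 : (0 : ℝ) ≤ (u ⟨j, hjs⟩ : ℕ) := Nat.cast_nonneg _
        constructor
        · exact nonneg_of_mul_nonneg_left (by linarith : 0 ≤ x j * N) hN0
        · exact le_of_mul_le_mul_right (by linarith : x j * N ≤ 1 * N) hN0
      · exact hj
    · have ha := h ⟨a, a.2.trans_le hs⟩
      simp only [a.2, dite_true] at ha
      rw [div_le_iff₀ hN0, le_div_iff₀ hN0] at ha
      rw [coord_of_lt (a.2.trans_le hs)]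
      simp only [Fin.eta] at ha
      constructor <;> linarith
  · rintro ⟨hc, hx⟩ j
    split_ifs with hjs
    · have ha := hx ⟨j, hjs⟩
      rw [coord_of_lt j.2] at ha
      simp only [Fin.eta] at ha
      rw [div_le_iff₀ hN0, le_div_iff₀ hN0]
      constructor <;> linarith
    · exact hc j

theorem volume_gridBox {n s N : ℕ} (hs : s ≤ n) (e f : ℝ) (u : Fin s → Fin N) :
    volume (gridBox n e f u) = ENNReal.ofReal ((f - e) / N) ^ s := by
  rw [gridBox, Real.volume_Icc_pi]
  have h : ∀ j : Fin n, ENNReal.ofReal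
      ((if h : (j : ℕ) < s then ((u ⟨j, h⟩ : ℝ) + f) / N else 1) -
        if h : (j : ℕ) < s then ((u ⟨j, h⟩ : ℝ) + e) / N else 0) =
      if (j : ℕ) < s then ENNReal.ofReal ((f - e) / N) else 1 := by
    intro j
    split_ifs
    · congr 1; ring
    · simp
  rw [Finset.prod_congr rfl fun j _ => h j, Fin.prod_univ_eq_prod_range
    (fun j => if j < s then ENNReal.ofReal ((f - e) / N) else 1) n, ← Finset.prod_filter]
  have : (Finset.range n).filter (fun j => j < s) = Finset.range s := by
    ext j; simp; omega
  rw [this, Finset.prod_const, Finset.card_range]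

/-- There are `N ^ s` cells, each with a plateau box of volume `(1 / (2 N)) ^ s`: the powers of `N`
cancel, leaving `(1 / 2) ^ s * δ² / 8`. -/
theorem le_minimaxRisk {n s N : ℕ} (hs : s ≤ n) (hN : 1 ≤ N) {b B : ℝ} (hb : 0 < b) (hB : 0 < B)
    (ν : Measure (Fin n → ℝ)) [IsProbabilityMeasure ν] {M : Set ((Fin n → ℝ) → ℝ)}
    (hM : ∀ w : (Fin s → Fin N) → Bool, hypothesis n b B w ∈ M) {T : ℕ} (hT : 1 ≤ T)
    (hn : 2 * n ≤ T) (hsum : n * ((N : ℝ) ^ (-(b * B))) ^ 2 +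
      T * (((N : ℝ) ^ (-(b * B))) ^ 2 * (1 / N) ^ s) ≤ 2) :
    1 / 2 * gaussianPDF 0 1 2 ^ n *
      ENNReal.ofReal ((1 / 2) ^ s * (((N : ℝ) ^ (-(b * B))) ^ 2 / 8)) ≤ minimaxRisk ν M T := by
  have hN0 : (0 : ℝ) < N := by exact_mod_cast hN
  have hmem := hypothesis_mem n (s := s) hN hb hB.le
  have hδ1 : (N : ℝ) ^ (-(b * B)) ≤ 1 :=
    Real.rpow_le_one_of_one_le_of_nonpos (by exact_mod_cast hN)
      (neg_nonpos.2 (mul_nonneg hb.le hB.le))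
  have h := assouad ν M hT hn (fun w : (Fin s → Fin N) → Bool => hypothesis n b B w) hM
    (measurable_hypothesis n b B)
    (fun w x => by rw [abs_of_nonneg (hmem w x).1]; exact (hmem w x).2.trans hδ1)
    (gridBox n (1 / 4) (3 / 4)) (gridBox n 0 1) (fun u => measurableSet_Icc)
    (fun u => measurableSet_Icc)
    (fun u x hx => ((mem_gridBox hs hN (by norm_num) (by norm_num)).1 hx).1) ?_
    (V := (1 / N) ^ s) (V' := ENNReal.ofReal ((3 / 4 - 1 / 4) / N) ^ s) (by positivity)
    (fun u => (volume_gridBox hs _ _ u).ge)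
    (fun u => by rw [volume_gridBox hs, sub_zero, ENNReal.ofReal_pow (by positivity)])
    (δ := (N : ℝ) ^ (-(b * B))) ?_ ?_ ?_ hsum
  · refine le_of_eq_of_le ?_ h
    congr 1
    rw [← ENNReal.ofReal_pow (by norm_num; positivity), ← ENNReal.ofReal_mul (by norm_num; positivity),
      ← ENNReal.ofReal_natCast, ← ENNReal.ofReal_mul (by positivity)]
    congr 1
    rw [← mul_assoc]
    congr 1
    rw [Fintype.card_fun, Fintype.card_fin, Fintype.card_fin, Nat.cast_pow, ← mul_pow]
    congr 1
    field_simp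
    norm_num
  · intro u u' hne
    refine Set.disjoint_left.2 fun x hx hx' => hne ?_
    refine cell_unique (z := scaledCoords n s N x) (fun a => ?_) (fun a => ?_)
    · have := ((mem_gridBox hs hN (by norm_num) (by norm_num)).1 hx).2 a
      constructor <;> linarith
    · have := ((mem_gridBox hs hN (by norm_num) (by norm_num)).1 hx').2 a
      constructor <;> linarith
  · intro w u x hx
    obtain ⟨hxc, hxu⟩ := (mem_gridBox hs hN (by norm_num) (by norm_num)).1 hx
    rw [hypothesis, Set.indicator_of_mem hxc, gridFun, bumpSum_of_mem w u hxu]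
    split_ifs
    · rw [mul_one, ← Real.rpow_mul hN0.le, neg_mul]
    · rw [mul_zero, Real.zero_rpow hB.ne']
  · intro w w' x
    have h1 := hmem w x
    have h2 := hmem w' x
    rw [abs_le]
    constructor <;> linarith
  · intro w u b' x hx
    unfold hypothesis
    by_cases hxc : x ∈ cube n 0 1
    · rw [Set.indicator_of_mem hxc, Set.indicator_of_mem hxc, gridFun, gridFun,
        bumpSum_update w u b' fun hu => hx ((mem_gridBox hs hN le_rfl le_rfl).2 ⟨hxc, hu⟩)]
    · rw [Set.indicator_of_notMem hxc, Set.indicator_of_notMem hxc]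

/-! ### The rate -/

/-- For every `T ≥ 1` the maximum is attained at the smallest exponent, so one layer `i` serves all
`T`. -/
theorem exists_rate_le {q : ℕ} (t : Fin (q + 1) → ℕ) (β : Fin (q + 1) → ℝ) :
    ∃ i, ∀ T : ℕ, 1 ≤ T → rate t β T ≤
      (T : ℝ) ^ (-(2 * effSmoothness β i / (2 * effSmoothness β i + (t i : ℝ)))) := by
  obtain ⟨i, -, hi⟩ := Finset.exists_min_image Finset.univ
    (fun i => 2 * effSmoothness β i / (2 * effSmoothness β i + (t i : ℝ))) Finset.univ_nonempty
  refine ⟨i, fun T hT => Finset.sup'_le _ _ fun j _ => ?_⟩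
  exact Real.rpow_le_rpow_of_exponent_le (by exact_mod_cast hT) (neg_le_neg (hi j (Finset.mem_univ j)))

/-- `N` balances `T * N ^ (-(2 e + s)) ≤ 1`; rounding up at most doubles a number `≥ 1`, which costs
only the factor `2 ^ (-(2 e))`. -/
theorem ceil_rpow_bounds {e : ℝ} {s : ℕ} (he : 0 < e) (hs : 1 ≤ s) {T : ℕ} (hT : 1 ≤ T) :
    let N := ⌈(T : ℝ) ^ (1 / (2 * e + s))⌉₊
    let r := (T : ℝ) ^ (-(2 * e / (2 * e + s)))
    1 ≤ N ∧ ((N : ℝ) ^ (-e)) ^ 2 ≤ r ∧ T * (((N : ℝ) ^ (-e)) ^ 2 * (1 / N) ^ s) ≤ 1 ∧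
      (2 : ℝ) ^ (-(2 * e)) * r ≤ ((N : ℝ) ^ (-e)) ^ 2 := by
  intro N r
  have hT1 : (1 : ℝ) ≤ T := by exact_mod_cast hT
  have hT0 : (0 : ℝ) < T := by linarith
  have hD : 0 < 2 * e + s := by positivity
  set y : ℝ := (T : ℝ) ^ (1 / (2 * e + s)) with hy
  have hy1 : 1 ≤ y := Real.one_le_rpow hT1 (by positivity)
  have hyN : y ≤ N := Nat.le_ceil y
  have hN2 : (N : ℝ) ≤ 2 * y := by
    have := Nat.ceil_lt_add_one (a := y) (by linarith)
    linarith
  have hN1 : (1 : ℝ) ≤ N := hy1.trans hyN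
  have hN0 : (0 : ℝ) < N := by linarith
  have hsq : ((N : ℝ) ^ (-e)) ^ 2 = (N : ℝ) ^ (-(2 * e)) := by
    rw [← Real.rpow_natCast, ← Real.rpow_mul hN0.le]
    congr 1; push_cast; ring
  have hr : r = y ^ (-(2 * e)) := by
    change (T : ℝ) ^ (-(2 * e / (2 * e + s))) = _
    rw [hy, ← Real.rpow_mul hT0.le]
    congr 1; ring
  have hyT : y ^ (2 * e + s) = T := by
    rw [hy, ← Real.rpow_mul hT0.le, one_div_mul_cancel hD.ne', Real.rpow_one]
  rw [hsq, hr]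
  refine ⟨by exact_mod_cast hN1, ?_, ?_, ?_⟩
  · exact Real.rpow_le_rpow_of_nonpos (by linarith) hyN (by linarith)
  · have h1 : (N : ℝ) ^ (-(2 * e)) * (1 / N) ^ s = (N : ℝ) ^ (-(2 * e + s)) := by
      rw [neg_add, Real.rpow_add hN0, Real.rpow_neg hN0.le (s : ℝ), Real.rpow_natCast, one_div,
        inv_pow]
    rw [h1, ← hyT, Real.rpow_neg hN0.le, ← div_eq_mul_inv]
    exact div_le_one_of_le₀ (Real.rpow_le_rpow (by linarith) hyN hD.le) (by positivity)
  · rw [← Real.mul_rpow zero_le_two (by linarith)]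
    exact Real.rpow_le_rpow_of_nonpos hN0 hN2 (by linarith)

theorem gaussianPDF_two_ne_zero : gaussianPDF 0 1 2 ≠ 0 :=
  (gaussianPDF_pos 0 one_ne_zero 2).ne'

end NonlinearAR

open NonlinearAR
theorem mainTheorem3 (q : ℕ) (d : Fin (q + 2) → ℕ) (t : Fin (q + 1) → ℕ) (β : Fin (q + 1) → ℝ)
    (hd : d (Fin.last (q + 1)) = 1)
    (ht_pos : ∀ i, 1 ≤ t i)
    (ht_le : ∀ i : Fin (q + 1), t i ≤ d i.castSucc)
    (hβ : ∀ i, 0 < β i)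
    (ht_min : ∀ i j : Fin (q + 1), i < j → t j ≤ d i.castSucc) :
    ∃ A₀ : ℝ, 0 < A₀ ∧ ∀ A : ℝ, A₀ ≤ A →
      ∀ c : Fin (d 0 + 1) → ℝ, (∀ i, 0 < c i) → ∑ i : Fin (d 0), c i.succ < 1 → A ≤ c 0 →
      ∀ (ν : Measure (Fin (d 0) → ℝ)) [IsProbabilityMeasure ν],
        Integrable (fun x => ‖WithLp.toLp 2 x‖) ν →
        0 < liminf (fun T : ℕ => (ENNReal.ofReal (rate t β T))⁻¹ *
          minimaxRisk ν (meanClass q d c t β A) T) atTop := by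
  obtain ⟨i, hi⟩ := exists_rate_le t β
  obtain ⟨A₀, hA₀, hmem⟩ := exists_hypothesis_mem_meanClass q d t β ht_pos ht_le hβ ht_min i
  refine ⟨A₀, hA₀, fun A hA c hc _ hAc ν _ _ => ?_⟩
  set B : ℝ := ∏ l ∈ Finset.Ioi i, min (β l) 1 with hBdef
  have hB : 0 < B := Finset.prod_pos fun l _ => lt_min (hβ l) one_pos
  have heff : effSmoothness β i = β i * B := rfl
  rw [heff] at hi
  set e : ℝ := β i * B with he
  have he0 : 0 < e := mul_pos (hβ i) hB
  have hs : t i ≤ d 0 := by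
    rcases (Fin.zero_le i).eq_or_lt with h | h
    · subst h; exact ht_le 0
    · exact ht_min 0 i h
  have hexp : 0 < 2 * e / (2 * e + (t i : ℝ)) := by positivity
  set C : ℝ≥0∞ := 1 / 2 * gaussianPDF 0 1 2 ^ d 0 *
    ENNReal.ofReal ((1 / 2) ^ t i * ((2 : ℝ) ^ (-(2 * e)) / 8)) with hC
  have hC0 : 0 < C := by
    refine pos_iff_ne_zero.2 (mul_ne_zero (mul_ne_zero (by simp)
      (pow_ne_zero _ gaussianPDF_two_ne_zero)) ?_)
    rw [Ne, ENNReal.ofReal_eq_zero, not_le]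
    positivity
  refine hC0.trans_le (le_liminf_of_le (by isBoundedDefault) ?_)
  have hlim : Tendsto (fun T : ℕ => (d 0 : ℝ) * (T : ℝ) ^ (-(2 * e / (2 * e + (t i : ℝ))))) atTop
      (nhds 0) := by
    simpa using ((tendsto_rpow_neg_atTop hexp).comp tendsto_natCast_atTop_atTop).const_mul (d 0 : ℝ)
  filter_upwards [hlim.eventually_le_const zero_lt_one, eventually_ge_atTop 1,
    eventually_ge_atTop (2 * d 0)] with T hT hT1 hTn
  obtain ⟨hN, h1, h2, h3⟩ := ceil_rpow_bounds he0 (ht_pos i) hT1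
  set N := ⌈(T : ℝ) ^ (1 / (2 * e + t i))⌉₊
  set r := (T : ℝ) ^ (-(2 * e / (2 * e + (t i : ℝ)))) with hr
  have hr0 : 0 < r := Real.rpow_pos_of_pos (by exact_mod_cast hT1) _
  -- The budget `2` splits evenly: the burn-in term is at most `d 0 * r ≤ 1` for large `T`, and the
  -- choice of `N` bounds the other term by `1`.
  have hle := le_minimaxRisk hs hN (hβ i) hB ν (hmem A hA c hc hAc N hN) hT1 hTn (by
    have := mul_le_mul_of_nonneg_left h1 (Nat.cast_nonneg (d 0))
    linarith)
  have hr' : (ENNReal.ofReal r)⁻¹ ≤ (ENNReal.ofReal (rate t β T))⁻¹ :=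
    ENNReal.inv_le_inv.2 (ENNReal.ofReal_le_ofReal (hi T hT1))
  refine le_trans ?_ (mul_le_mul' hr' hle)
  calc C = (ENNReal.ofReal r)⁻¹ * ENNReal.ofReal r * C := by
        rw [ENNReal.inv_mul_cancel (by simpa using hr0) ENNReal.ofReal_ne_top, one_mul]
    _ = (ENNReal.ofReal r)⁻¹ * (1 / 2 * gaussianPDF 0 1 2 ^ d 0 * (ENNReal.ofReal r *
          ENNReal.ofReal ((1 / 2) ^ t i * ((2 : ℝ) ^ (-(2 * e)) / 8)))) := by
        rw [hC]; ring
    _ ≤ _ := by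
        rw [← ENNReal.ofReal_mul hr0.le]
        refine mul_le_mul_right (mul_le_mul_right (ENNReal.ofReal_le_ofReal ?_) _) _
        calc r * ((1 / 2) ^ t i * ((2 : ℝ) ^ (-(2 * e)) / 8)) =
            (1 / 2) ^ t i * ((2 : ℝ) ^ (-(2 * e)) * r / 8) := by ring
          _ ≤ _ := by gcongr
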